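/- A system has $m\ge 1$ machines with ids $0,\dots,m-1$ and tasks of two sizes $0<\ell_{\min}<\ell_{\max}$; put $\rho=\ell_{\max}/\ell_{\min}$ and $\bar\rho=\lfloor\rho\rfloor$. An arrival pattern $A$ is a finite or infinite sequence of task injections, ordered by time; an error pattern $E$ lists, for each machine, alternating restart and crash times (initial awakening counts as a restart); times are nonnegative and only finitely many events occur in bounded time. All machines see the set of pending tasks (injected and not yet completed); at any instant, completions come first, then injections, then the machines' decisions. An alive machine that is not executing a task may start a pending task of size $\ell$; the task is completed after $\ell$ time units (no speedup) if the machine does not crash before then, and all progress is lost at a crash; several machines may execute the same task. The completed load $C_t(X,A,E)$ of an algorithm $X$ is the sum of the sizes of the distinct tasks completed by time $t$. Algorithm $\rho m$-Preamble: let $L_{\min}$, $L_{\max}$ be the lists of currently pending tasks of size $\ell_{\min}$, $\ell_{\max}$, sorted by arrival, with positions numbered from $0$. When machine $p$ awakes or restarts it waits, if necessary, until some task is pending, sets $c=0$, and sets $\mathit{preamble}$ to true if $|L_{\min}|\ge\bar\rho m^2$ and to false otherwise. Then, whenever it is alive, is not executing a task and some task is pending, it does the following: if $\mathit{preamble}$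 is true and $c<\bar\rho$, it executes the task at position $pm$ of $L_{\min}$ and increases $c$ by one; else if $|L_{\max}|\ge m^2$, the task at position $pm$ of $L_{\max}$; else if $|L_{\min}|\ge m^2$, the task at position $pm$ of $L_{\min}$; else if $L_{\max}\ne\emptyset$, the task at position $pm \bmod |L_{\max}|$ of $L_{\max}$; else the task at position $pm\bmod|L_{\min}|$ of $L_{\min}$. Theorem. Without speedup, $\rho m$-Preamble is $\frac{\bar\rho}{\rho+\bar\rho}$-completed-load competitive: there is a constant $\Delta$, depending only on $m,\ell_{\min},\ell_{\max}$, such that for every time $t\ge 0$, every (possibly offline) algorithm $X$ without speedup, and all arrival and error patterns $A$ and $E$, $$C_t(\rho m\text{-Preamble},A,E)\;\ge\;\frac{\bar\rho}{\rho+\bar\rho}\,C_t(X,A,E)+\Delta .$$ -/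

import Mathlib

open Set

noncomputable section

namespace CrashScheduling

/-- The fixed parameters of the system: `m ≥ 1` machines and two different task sizes
`0 < ℓmin < ℓmax`. -/
structure System where
  m : ℕ
  ℓmin : ℝ
  ℓmax : ℝ
  m_pos : 0 < m
  ℓmin_pos : 0 < ℓmin
  ℓmin_lt_ℓmax : ℓmin < ℓmax

/-- `ρ = ℓmax / ℓmin`. -/
def System.rho (P : System) : ℝ := P.ℓmax / P.ℓmin

/-- `ρ̄ = ⌊ρ⌋`. -/
def System.rhoBar (P : System) : ℕ := ⌊P.rho⌋₊

/-- An arrival pattern: a finite or infinite sequence of task injections. The tasks are the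
indices in `task`, listed in order of arrival; simultaneous injections are allowed, and only
finitely many tasks are injected in bounded time. (The values of `arr` and `size` at indices
outside `task` play no role.) -/
structure ArrivalPattern (P : System) where
  task : Set ℕ
  arr : ℕ → ℝ
  size : ℕ → ℝ
  size_mem : ∀ i, size i = P.ℓmin ∨ size i = P.ℓmax
  arr_nonneg : ∀ i ∈ task, 0 ≤ arr i
  arr_mono : ∀ i ∈ task, ∀ j ∈ task, i ≤ j → arr i ≤ arr j
  finite_arr : ∀ t, {i | i ∈ task ∧ arr i ≤ t}.Finite

/-- An error pattern: for each machine, the times of its crash events and of its restart events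
(the initial awaking of a machine counts as a restart; a machine is down until then). The two
kinds of events alternate, beginning with a restart; a restart may happen at the very instant of
the preceding crash. Only finitely many events happen in bounded time. -/
structure ErrorPattern (P : System) where
  crash : Fin P.m → Set ℝ
  restart : Fin P.m → Set ℝ
  restart_nonneg : ∀ p, ∀ r ∈ restart p, 0 ≤ r
  restart_before_crash : ∀ p, ∀ c ∈ crash p, ∃ r ∈ restart p, r < c
  crash_between : ∀ p, ∀ r ∈ restart p, ∀ r' ∈ restart p, r < r' → ∃ c ∈ crash p, r < c ∧ c ≤ r'
  restart_between : ∀ p, ∀ c ∈ crash p, ∀ c' ∈ crash p, c < c' → ∃ r ∈ restart p, c ≤ r ∧ r < c'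
  finite_crash : ∀ p t, {c | c ∈ crash p ∧ c ≤ t}.Finite
  finite_restart : ∀ p t, {r | r ∈ restart p ∧ r ≤ t}.Finite

/-- Machine `p` restarts at time `r` and does not crash in `(r, t]`: it is alive at time `t`, and
has been so since `r`. -/
def ErrorPattern.AliveSince {P : System} (E : ErrorPattern P) (p : Fin P.m) (r t : ℝ) : Prop :=
  r ∈ E.restart p ∧ r ≤ t ∧ ∀ c ∈ E.crash p, r < c → t < c

/-- A schedule records the starts of the processing cycles: `S p t = some i` says that machine `p`
starts executing task `i` at time `t`, and `S p t = none` that it starts nothing at time `t`. -/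
abbrev Schedule (P : System) : Type := Fin P.m → ℝ → Option ℕ

section Execution

variable {P : System} (A : ArrivalPattern P) (E : ErrorPattern P) (S : Schedule P)

/-- Task `i` has been completed by time `t` (inclusive): some machine has executed it from start
to end, without speedup and without a crash in between. A crash at the very instant of the
completion comes after the completion. -/
def Completed (t : ℝ) (i : ℕ) : Prop :=
  ∃ p s, S p s = some i ∧ s + A.size i ≤ t ∧ ∀ c ∈ E.crash p, s < c → s + A.size i ≤ c

/-- The pending tasks at time `t`: injected by time `t` (inclusive) and not completed by time `t`
(inclusive). -/
def pending (t : ℝ) : Set ℕ := {i | i ∈ A.task ∧ A.arr i ≤ t ∧ ¬ Completed A E S t i}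

/-- The queue `L_ℓ` at time `t`: the pending tasks of size `ℓ`. -/
def queue (ℓ t : ℝ) : Set ℕ := {i | i ∈ pending A E S t ∧ A.size i = ℓ}

/-- At time `t` machine `p` is in the middle of a processing cycle that it started before. -/
def Busy (p : Fin P.m) (t : ℝ) : Prop :=
  ∃ s j, S p s = some j ∧ s < t ∧ t < s + A.size j ∧ ∀ c ∈ E.crash p, s < c → t < c

/-- The schedules that are possible under the patterns `A` and `E`: a machine starts a cycle only
when it is alive and not in the middle of another one, and only with a pending task. -/
def Legal : Prop :=
  ∀ p t i, S p t = some i →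
    (∃ r, E.AliveSince p r t) ∧ ¬ Busy A E S p t ∧ i ∈ pending A E S t

open Classical in
/-- The completed load: the sum of the sizes of the tasks completed by time `t`. -/
def completedLoad (t : ℝ) : ℝ :=
  ∑ i ∈ (A.finite_arr t).toFinset with Completed A E S t i, A.size i

/-- The times in `[r, t)` at which machine `p` starts a cycle. -/
def startsIn (p : Fin P.m) (r t : ℝ) : Set ℝ := {s | r ≤ s ∧ s < t ∧ S p s ≠ none}

end Execution

/-- An arbitrary scheduling algorithm, possibly offline: it has a legal execution under every pair
of patterns. -/
structure Algorithm (P : System) where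
  sched : ArrivalPattern P → ErrorPattern P → Schedule P
  legal : ∀ A E, Legal A E (sched A E)

/-- `ALG`, running without speedup, is `α`-completed-load competitive; the additive constant `Δ`
depends neither on the time nor on the competitor `X` nor on the patterns `A` and `E`. -/
def CompletedLoadCompetitive {P : System} (ALG : Algorithm P) (α : ℝ) : Prop :=
  ∃ Δ : ℝ, ∀ (t : ℝ) (X : Algorithm P) (A : ArrivalPattern P) (E : ErrorPattern P), 0 ≤ t →
    completedLoad A E (ALG.sched A E) t ≥ α * completedLoad A E (X.sched A E) t + Δ

open Classical in
/-- The task at position `k` of the queue `L`, sorted by arrival, with positions counted from `0`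
(if there is such a position). -/
def taskAt (L : Set ℕ) (k : ℕ) : Option ℕ :=
  if k < L.ncard then some (Nat.nth (fun i => i ∈ L) k) else none

/-! ### The algorithm `ρm-Preamble` -/

section Preamble

variable {P : System} (A : ArrivalPattern P) (E : ErrorPattern P) (S : Schedule P)

/-- `|L_ℓmin| ≥ ρ̄ m²` at time `t`. -/
def EnoughSmall (t : ℝ) : Prop := P.rhoBar * P.m ^ 2 ≤ (queue A E S P.ℓmin t).ncard

/-- The value, at time `t`, of the variable `preamble` of machine `p`, alive since `r`. It is set
after the restart at `r` as soon as the blocking `get` returns, which is when the first cycle after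
`r` starts (at time `t` itself if there has not been one before `t`). -/
def PreambleFlag (p : Fin P.m) (r t : ℝ) : Prop :=
  (startsIn S p r t = ∅ ∧ EnoughSmall A E S t) ∨
    ∃ s, IsLeast (startsIn S p r t) s ∧ EnoughSmall A E S s

/-- The test `preamble = TRUE ∧ c < ρ̄` of machine `p` at a decision time `t`. When `preamble` is
true, `c` has been increased in each cycle since the restart until it reached `ρ̄`, so that `c < ρ̄`
says that there have been fewer than `ρ̄` such cycles. -/
def InPreamble (p : Fin P.m) (t : ℝ) : Prop :=
  ∃ r, E.AliveSince p r t ∧ PreambleFlag A E S p r t ∧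
    (startsIn S p r t).encard < (P.rhoBar : ℕ∞)

open Classical in
/-- The task chosen by machine `p` in the loop of the algorithm at a decision time `t`. -/
def select (p : Fin P.m) (t : ℝ) : Option ℕ :=
  let Lmin := queue A E S P.ℓmin t
  let Lmax := queue A E S P.ℓmax t
  if InPreamble A E S p t then taskAt Lmin (p * P.m)
  else if P.m ^ 2 ≤ Lmax.ncard then taskAt Lmax (p * P.m)
  else if P.m ^ 2 ≤ Lmin.ncard then taskAt Lmin (p * P.m)
  else if Lmax.Nonempty then taskAt Lmax ((p * P.m) % Lmax.ncard)
  else if Lmin.Nonempty then taskAt Lmin ((p * P.m) % Lmin.ncard)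
  else none

open Classical in
/-- What machine `p` running the algorithm starts at time `t`, given the schedule before `t`: it
makes a decision whenever it is alive and not in the middle of a cycle. -/
def decision (p : Fin P.m) (t : ℝ) : Option ℕ :=
  if (∃ r, E.AliveSince p r t) ∧ ¬ Busy A E S p t then select A E S p t else none

/-- `S` is the execution of the algorithm under the patterns `A` and `E`: at each time each machine
does what the algorithm prescribes. Since `decision` depends on `S` only through the cycles that
have started before `t`, this determines `S`. -/
def IsRun : Prop := ∀ p t, S p t = decision A E S p t

end Preamble

/-! ### The algorithm has a legal execution under every pair of patterns -/

section Existence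

variable {P : System} {A : ArrivalPattern P} {E : ErrorPattern P} {S S' : Schedule P}

theorem ℓmin_le_size (A : ArrivalPattern P) (i : ℕ) : P.ℓmin ≤ A.size i := by
  rcases A.size_mem i with h | h <;> rw [h]
  exact P.ℓmin_lt_ℓmax.le

theorem size_pos (A : ArrivalPattern P) (i : ℕ) : 0 < A.size i :=
  P.ℓmin_pos.trans_le (ℓmin_le_size A i)

theorem taskAt_mem {L : Set ℕ} {k i : ℕ} (h : taskAt L k = some i) : i ∈ L := by
  unfold taskAt at h
  split_ifs at h with hk
  have h2 := Option.some.inj h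
  subst h2
  refine Nat.nth_mem (p := fun i => i ∈ L) k fun hf => ?_
  rwa [Set.ncard_eq_toFinset_card L hf] at hk

theorem select_mem {p : Fin P.m} {t : ℝ} {i : ℕ} (h : select A E S p t = some i) :
    i ∈ pending A E S t := by
  have h1 : ∀ ℓ k, taskAt (queue A E S ℓ t) k = some i → i ∈ pending A E S t :=
    fun ℓ k hk => (taskAt_mem hk).1
  unfold select at h
  dsimp only at h
  split_ifs at h <;> exact h1 _ _ h

theorem IsRun.legal (h : IsRun A E S) : Legal A E S := by
  intro p t i hi
  rw [h p t] at hi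
  unfold decision at hi
  split_ifs at hi with hc
  exact ⟨hc.1, hc.2, select_mem hi⟩

section Locality

variable {t : ℝ}

theorem completed_congr (h : ∀ q s, s < t → S q s = S' q s) {u : ℝ} (hu : u ≤ t) (i : ℕ) :
    Completed A E S u i ↔ Completed A E S' u i := by
  unfold Completed
  refine exists_congr fun p => exists_congr fun s => ?_
  have := size_pos A i
  constructor
  · rintro ⟨a, b, c⟩
    exact ⟨by rw [← h p s (by linarith)]; exact a, b, c⟩
  · rintro ⟨a, b, c⟩
    exact ⟨by rw [h p s (by linarith)]; exact a, b, c⟩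

theorem queue_congr (h : ∀ q s, s < t → S q s = S' q s) {u : ℝ} (hu : u ≤ t) (ℓ : ℝ) :
    queue A E S ℓ u = queue A E S' ℓ u := by
  ext i
  simp only [queue, pending, mem_ofPred_eq, completed_congr h hu]

theorem startsIn_congr (h : ∀ q s, s < t → S q s = S' q s) (p : Fin P.m) (r : ℝ) :
    startsIn S p r t = startsIn S' p r t := by
  ext s
  simp only [startsIn, mem_ofPred_eq]
  refine and_congr_right fun _ => and_congr_right fun hs => ?_
  rw [h p s hs]

theorem inPreamble_congr (h : ∀ q s, s < t → S q s = S' q s) (p : Fin P.m) :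
    InPreamble A E S p t ↔ InPreamble A E S' p t := by
  unfold InPreamble PreambleFlag EnoughSmall
  refine exists_congr fun r => ?_
  rw [startsIn_congr h, queue_congr h le_rfl]
  refine and_congr_right fun _ => and_congr_left fun _ => or_congr_right ?_
  refine exists_congr fun s => and_congr_right fun hs => ?_
  rw [queue_congr h hs.1.2.1.le]

theorem busy_congr (h : ∀ q s, s < t → S q s = S' q s) (p : Fin P.m) :
    Busy A E S p t ↔ Busy A E S' p t := by
  unfold Busy
  refine exists_congr fun s => exists_congr fun j => ?_
  constructor
  · rintro ⟨a, b, c⟩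
    exact ⟨by rw [← h p s b]; exact a, b, c⟩
  · rintro ⟨a, b, c⟩
    exact ⟨by rw [h p s b]; exact a, b, c⟩

/-- A decision at time `t` depends only on the cycles that have started before `t`. -/
theorem decision_congr (h : ∀ q s, s < t → S q s = S' q s) (p : Fin P.m) :
    decision A E S p t = decision A E S' p t := by
  unfold decision select
  rw [propext (busy_congr h p), propext (inPreamble_congr h p), queue_congr h le_rfl P.ℓmin,
    queue_congr h le_rfl P.ℓmax]

end Locality

/-- A locally finite set of times that contains all decision times. -/
def grid (A : ArrivalPattern P) (E : ErrorPattern P) : Set ℝ :=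
  {d | ∃ e, ((∃ p, e ∈ E.restart p) ∨ ∃ i ∈ A.task, A.arr i = e) ∧
    ∃ a b : ℕ, d = e + a * P.ℓmin + b * P.ℓmax}

theorem restart_mem_grid {p : Fin P.m} {r : ℝ} (h : r ∈ E.restart p) : r ∈ grid A E :=
  ⟨r, Or.inl ⟨p, h⟩, 0, 0, by simp⟩

theorem arr_mem_grid {i : ℕ} (h : i ∈ A.task) : A.arr i ∈ grid A E :=
  ⟨A.arr i, Or.inr ⟨i, h, rfl⟩, 0, 0, by simp⟩

theorem add_size_mem_grid {d : ℝ} (h : d ∈ grid A E) (i : ℕ) : d + A.size i ∈ grid A E := by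
  obtain ⟨e, he, a, b, rfl⟩ := h
  rcases A.size_mem i with hs | hs
  · exact ⟨e, he, a + 1, b, by rw [hs]; push_cast; ring⟩
  · exact ⟨e, he, a, b + 1, by rw [hs]; push_cast; ring⟩

theorem grid_finite (A : ArrivalPattern P) (E : ErrorPattern P) (t : ℝ) :
    (grid A E ∩ Iic t).Finite := by
  have hev : ({e | ∃ p, e ∈ E.restart p ∧ e ≤ t} ∪
      A.arr '' {i | i ∈ A.task ∧ A.arr i ≤ t}).Finite := by
    refine Set.Finite.union ?_ ((A.finite_arr t).image _)
    have : {e | ∃ p, e ∈ E.restart p ∧ e ≤ t} = ⋃ p, {e | e ∈ E.restart p ∧ e ≤ t} := by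
      ext; simp
    rw [this]
    exact Set.finite_iUnion fun p => E.finite_restart p t
  obtain ⟨N, hN⟩ := exists_nat_ge (t / P.ℓmin)
  refine (((hev.prod (Set.finite_Iic N)).prod (Set.finite_Iic N)).image
    fun x : (ℝ × ℕ) × ℕ => x.1.1 + x.1.2 * P.ℓmin + x.2 * P.ℓmax).subset ?_
  rintro d ⟨⟨e, he, a, b, rfl⟩, hd⟩
  have hd' : e + a * P.ℓmin + b * P.ℓmax ≤ t := hd
  have hp := P.ℓmin_pos
  have hlt := P.ℓmin_lt_ℓmax
  have he0 : 0 ≤ e := by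
    rcases he with ⟨p, h⟩ | ⟨i, hi, rfl⟩
    · exact E.restart_nonneg p e h
    · exact A.arr_nonneg i hi
  have ha0 : (0 : ℝ) ≤ a * P.ℓmin := by positivity
  have hb1 : (b : ℝ) * P.ℓmin ≤ b * P.ℓmax := by gcongr
  have hb0 : (0 : ℝ) ≤ b * P.ℓmin := by positivity
  have hNt : t ≤ N * P.ℓmin := by rwa [div_le_iff₀ hp] at hN
  have bound : ∀ k : ℕ, (k : ℝ) * P.ℓmin ≤ t → k ≤ N := by
    intro k hk
    have h1 : (k : ℝ) * P.ℓmin ≤ N * P.ℓmin := hk.trans hNt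
    exact_mod_cast le_of_mul_le_mul_right h1 hp
  refine ⟨((e, a), b), ⟨⟨?_, bound a (by linarith)⟩, bound b (by linarith)⟩, rfl⟩
  rcases he with ⟨p, h⟩ | ⟨i, hi, rfl⟩
  · exact Or.inl ⟨p, h, by linarith⟩
  · exact Or.inr ⟨i, ⟨hi, by linarith⟩, rfl⟩

/-- A schedule that starts cycles only at grid times, and follows the algorithm there, follows the
algorithm at all times. -/
theorem isRun_of_grid (h0 : ∀ p t, t ∉ grid A E → S p t = none)
    (h1 : ∀ p, ∀ t ∈ grid A E, S p t = decision A E S p t) : IsRun A E S := by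
  intro p t
  by_cases ht : t ∈ grid A E
  · exact h1 p t ht
  rw [h0 p t ht]
  by_contra hne
  have hdec : (∃ r, E.AliveSince p r t) ∧ ¬ Busy A E S p t := by
    by_contra hc
    exact hne (by unfold decision; rw [if_neg hc])
  obtain ⟨⟨r, hr⟩, hbusy⟩ := hdec
  have hrg : r ∈ grid A E := restart_mem_grid hr.1
  obtain ⟨d, ⟨hdg, hdt⟩, hdmax⟩ := (grid_finite A E t).exists_maximal ⟨r, hrg, hr.2.1⟩
  have hdt : d ≤ t := hdt
  have hmax : ∀ x ∈ grid A E, x ≤ t → x ≤ d := fun x hx hxt => by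
    by_contra hlt
    exact hlt (hdmax ⟨hx, hxt⟩ (not_le.mp hlt).le)
  have hlt : d < t := lt_of_le_of_ne hdt fun h => ht (h ▸ hdg)
  have hstart : ∀ q s j, S q s = some j → s ∈ grid A E := fun q s j hs => by
    by_contra hn
    rw [h0 q s hn] at hs
    cases hs
  have hrd : r ≤ d := hmax r hrg hr.2.1
  have hcr : ∀ c ∈ E.crash p, d < c → t < c := fun c hc hdc => hr.2.2 c hc (hrd.trans_lt hdc)
  have hnone : S p d = none := by
    by_contra hn
    obtain ⟨j, hj⟩ := Option.ne_none_iff_exists'.mp hn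
    refine hbusy ⟨d, j, hj, hlt, ?_, hcr⟩
    by_contra hle
    have := hmax _ (add_size_mem_grid hdg j) (not_lt.mp hle)
    have := size_pos A j
    linarith
  have hbusyd : ¬ Busy A E S p d := by
    rintro ⟨s, j, hs, hsd, hds, hc⟩
    refine hbusy ⟨s, j, hs, hsd.trans hlt, ?_, fun c hcc hsc => hcr c hcc (hc c hcc hsc)⟩
    by_contra hle
    have := hmax _ (add_size_mem_grid (hstart p s j hs) j) (not_lt.mp hle)
    linarith
  have halive : ∀ r', E.AliveSince p r' t ↔ E.AliveSince p r' d := by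
    intro r'
    constructor
    · rintro ⟨a, b, c⟩
      exact ⟨a, hmax _ (restart_mem_grid a) b, fun x hx hrx => hlt.trans (c x hx hrx)⟩
    · rintro ⟨a, b, c⟩
      exact ⟨a, b.trans hdt, fun x hx hrx => hcr x hx (c x hx hrx)⟩
  have hcomp : ∀ i, Completed A E S t i ↔ Completed A E S d i := by
    intro i
    constructor
    · rintro ⟨q, s, hs, hst, hc⟩
      exact ⟨q, s, hs, hmax _ (add_size_mem_grid (hstart q s i hs) i) hst, hc⟩
    · rintro ⟨q, s, hs, hst, hc⟩
      exact ⟨q, s, hs, hst.trans hdt, hc⟩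
  have hqueue : ∀ ℓ, queue A E S ℓ t = queue A E S ℓ d := by
    intro ℓ
    ext i
    simp only [queue, pending, mem_ofPred_eq, hcomp]
    refine and_congr_left fun _ => and_congr_right fun hi => and_congr_left fun _ => ?_
    exact ⟨fun h => hmax _ (arr_mem_grid hi) h, fun h => h.trans hdt⟩
  have hstarts : ∀ r', startsIn S p r' t = startsIn S p r' d := by
    intro r'
    ext s
    simp only [startsIn, mem_ofPred_eq]
    refine and_congr_right fun _ => ⟨fun h => ⟨?_, h.2⟩, fun h => ⟨h.1.trans hlt, h.2⟩⟩
    obtain ⟨j, hj⟩ := Option.ne_none_iff_exists'.mp h.2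
    refine lt_of_le_of_ne (hmax s (hstart p s j hj) h.1.le) fun hsd => h.2 (hsd ▸ hnone)
  have hpre : InPreamble A E S p t ↔ InPreamble A E S p d := by
    unfold InPreamble PreambleFlag
    simp only [halive, hstarts, EnoughSmall, hqueue]
  have hsel : select A E S p t = select A E S p d := by
    unfold select
    rw [propext hpre, hqueue P.ℓmin, hqueue P.ℓmax]
  apply hne
  have h2 := h1 p d hdg
  rw [hnone] at h2
  unfold decision at h2 ⊢
  rw [if_pos ⟨⟨r, (halive r).mp hr⟩, hbusyd⟩] at h2
  rw [if_pos ⟨⟨r, hr⟩, hbusy⟩, hsel, ← h2]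

theorem wellFounded_grid (A : ArrivalPattern P) (E : ErrorPattern P) :
    WellFounded fun s t : ℝ => s ∈ grid A E ∧ s < t := by
  refine Subrelation.wf (r := InvImage (· < ·) fun t : ℝ => (grid A E ∩ Iio t).ncard) ?_
    (InvImage.wf _ wellFounded_lt)
  rintro s t ⟨hs, hst⟩
  refine Set.ncard_lt_ncard (ssubset_iff_subset_ne.mpr ⟨fun x hx => ⟨hx.1, hx.2.trans hst⟩, ?_⟩)
    ((grid_finite A E t).subset fun x hx => ⟨hx.1, (mem_Iio.mp hx.2).le⟩)
  intro heq
  have : s ∈ grid A E ∩ Iio s := heq ▸ ⟨hs, hst⟩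
  exact lt_irrefl s this.2

theorem exists_isRun (A : ArrivalPattern P) (E : ErrorPattern P) : ∃ S, IsRun A E S := by
  classical
  let F : (t : ℝ) → ((s : ℝ) → (s ∈ grid A E ∧ s < t) → Fin P.m → Option ℕ) →
      Fin P.m → Option ℕ := fun t rec p =>
    if t ∈ grid A E then
      decision A E (fun q s => if h : s ∈ grid A E ∧ s < t then rec s h q else none) p t
    else none
  let S : Schedule P := fun p t => (wellFounded_grid A E).fix F t p
  have hS : ∀ p t, S p t = F t (fun s _ q => S q s) p := fun p t =>
    congrFun ((wellFounded_grid A E).fix_eq F t) p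
  have h0 : ∀ p t, t ∉ grid A E → S p t = none := fun p t ht => by
    rw [hS]
    exact if_neg ht
  refine ⟨S, isRun_of_grid h0 fun p t ht => ?_⟩
  rw [hS]
  refine (if_pos ht).trans (decision_congr (fun q s hs => ?_) p)
  by_cases hg : s ∈ grid A E
  · simp [hg, hs]
  · simp [hg, h0 q s hg]

end Existence

/-- The algorithm `ρm-Preamble`. -/
def rhoMPreamble (P : System) : Algorithm P where
  sched A E := (exists_isRun A E).choose
  legal A E := (exists_isRun A E).choose_spec.legal

end CrashScheduling

end

open Set

noncomputable section

namespace CrashScheduling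

/-! ### Uninterrupted intervals and the cycles in them -/

variable {P : System} {A : ArrivalPattern P} {E : ErrorPattern P} {S : Schedule P}

/-! Write k for `rhoBar`, ℓ and M for the small and the large size, S for the run and Y for the
competitor. The goal is kℓ·C(Y) ≤ (M + kℓ)·C(S) up to a constant.

While one of the queues has at least m² tasks, the run wastes nothing: no machine idles
(`IsRun.start_of_not_busy`), and the spacing m between positions makes all completed cycles complete
different tasks (`Legal.eq_of_atOwnPosition`). Hence completions can be counted separately in each
phase, from a restart to the next crash or the horizon. In a phase Y completes at most the length of
the phase, and S at least that length minus M.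

Let u be the last time up to the horizon t when fewer than k m² small tasks were pending, and w the
last time up to u when fewer than m² large ones were (`exists_window`). At u, Y leads by boundedly
many small tasks; at w, by boundedly many large ones.

After u every new phase begins with k small tasks. The loss of M is thus harmless: a phase shorter
than kℓ ≤ M lets Y complete only small tasks, as many of which S completes, and in a longer one S
completes at least kℓ (`System.small_phase_bound`). Between w and u the small tasks of Y are already
paid for, so only the large ones matter. If Y completes y large tasks in a phase, and S completes a
small and b large ones, then kℓy ≤ (M + kℓ)b + ℓa (`System.large_phase_bound`).

Up to u, the last inequality times M is added to kℓ times the comparison of small loads. A small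
task of S is then charged Mℓ for large tasks of Y and kℓ·ℓ for small ones, in total exactly (M +
kℓ)ℓ. Phases running at u or w cost a constant per machine. -/

theorem aliveSince_unique {p : Fin P.m} {r r' t : ℝ} (h : E.AliveSince p r t)
    (h' : E.AliveSince p r' t) : r = r' := by
  by_contra hne
  wlog hlt : r < r' generalizing r r'
  · exact this h' h (Ne.symm hne) (lt_of_le_of_ne (not_lt.mp hlt) (Ne.symm hne))
  obtain ⟨c, hc, hrc, hcr⟩ := E.crash_between p r h.1 r' h'.1 hlt
  have := h.2.2 c hc hrc
  have := h'.2.1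
  linarith

theorem aliveSince_of_le {p : Fin P.m} {r t u : ℝ} (h : E.AliveSince p r t) (hr : r ≤ u)
    (hu : u ≤ t) : E.AliveSince p r u :=
  ⟨h.1, hr, fun c hc hrc => hu.trans_lt (h.2.2 c hc hrc)⟩

/-- Two cycles of a machine do not overlap unless there is a crash in between. -/
theorem Legal.add_size_le (hS : Legal A E S) {p : Fin P.m} {s s' : ℝ} {i j : ℕ}
    (hi : S p s = some i) (hj : S p s' = some j) (hss : s < s')
    (hc : ∀ c ∈ E.crash p, s < c → s' < c) : s + A.size i ≤ s' := by
  by_contra hlt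
  exact (hS p s' j hj).2.1 ⟨s, i, hi, hss, not_le.mp hlt, hc⟩

/-- A cycle begun before the restart `r` would have been cut by the crash that precedes `r`. -/
theorem Legal.exists_cycle_of_busy (hS : Legal A E S) {p : Fin P.m} {r v : ℝ}
    (hr : E.AliveSince p r v) (hb : Busy A E S p v) :
    ∃ s i, S p s = some i ∧ r ≤ s ∧ s < v ∧ v < s + A.size i := by
  obtain ⟨s, i, hi, hsv, hvs, hc⟩ := hb
  refine ⟨s, i, hi, ?_, hsv, hvs⟩
  by_contra hlt
  obtain ⟨⟨r', hr'⟩, -⟩ := hS p s i hi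
  obtain ⟨c, hcc, hrc, hcr⟩ :=
    E.crash_between p r' hr'.1 r hr.1 (hr'.2.1.trans_lt (not_le.mp hlt))
  have := hc c hcc (hr'.2.2 c hcc hrc)
  have := hr.2.1
  linarith

theorem Legal.not_busy_restart (hS : Legal A E S) {p : Fin P.m} {r v : ℝ}
    (hr : E.AliveSince p r v) : ¬ Busy A E S p r := by
  intro hb
  obtain ⟨s, i, -, hrs, hsr, -⟩ := hS.exists_cycle_of_busy (aliveSince_of_le hr le_rfl hr.2.1) hb
  linarith

theorem Completed.mono {t u : ℝ} (htu : t ≤ u) {i : ℕ} (h : Completed A E S t i) :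
    Completed A E S u i := by
  obtain ⟨p, s, hs, hst, hc⟩ := h
  exact ⟨p, s, hs, hst.trans htu, hc⟩

theorem Legal.mem_of_completed (hS : Legal A E S) {t : ℝ} {i : ℕ} (h : Completed A E S t i) :
    i ∈ A.task ∧ A.arr i ≤ t := by
  obtain ⟨p, s, hs, hst, -⟩ := h
  have h1 := (hS p s i hs).2.2
  have := size_pos A i
  exact ⟨h1.1, h1.2.1.trans (by linarith)⟩

theorem queue_finite (ℓ t : ℝ) : (queue A E S ℓ t).Finite :=
  (A.finite_arr t).subset fun _ hi => ⟨hi.1.1, hi.1.2.1⟩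

/-- In a time window of length `n ℓ` each machine completes at most `n` cycles of length `ℓ`. -/
theorem Legal.ncard_le_of_completed_between (hS : Legal A E S) {u v ℓ : ℝ} {n : ℕ}
    (hℓ : 0 < ℓ) (hv : v ≤ u + n * ℓ) {T : Set ℕ}
    (hT : ∀ i ∈ T, A.size i = ℓ ∧ ¬ Completed A E S u i ∧ Completed A E S v i) :
    T.ncard ≤ n * P.m := by
  have h1 : ∀ i : ℕ, ∃ x : Fin P.m × ℝ, i ∈ T → S x.1 x.2 = some i ∧ u < x.2 + ℓ ∧
      x.2 + ℓ ≤ v ∧ ∀ c ∈ E.crash x.1, x.2 < c → x.2 + ℓ ≤ c := by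
    intro i
    by_cases hi : i ∈ T
    · obtain ⟨hsz, hn, p, s, hs, hsv, hc⟩ := hT i hi
      refine ⟨(p, s), fun _ => ?_⟩
      rw [hsz] at hsv hc
      refine ⟨hs, ?_, hsv, hc⟩
      by_contra hle
      exact hn ⟨p, s, hs, by rw [hsz]; exact not_lt.mp hle, by rw [hsz]; exact hc⟩
    · exact ⟨(⟨0, P.m_pos⟩, 0), fun h => absurd h hi⟩
  choose x hx using h1
  -- A task is sent to its machine and to the slot (u + (k-1)ℓ, u + kℓ] containing its completion
  -- time. Two cycles of one machine that end in the same slot start less than ℓ apart, hence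
  -- coincide.
  let f : ℕ → Fin P.m × ℕ := fun i => ((x i).1, ⌈((x i).2 + ℓ - u) / ℓ⌉₊)
  let F : Finset (Fin P.m × ℕ) := Finset.univ ×ˢ Finset.Icc 1 n
  have hF : F.card = n * P.m := by simp [F, mul_comm]
  rw [← hF, ← Set.ncard_coe_finset]
  refine Set.ncard_le_ncard_of_injOn f ?_ ?_ (Finset.finite_toSet _)
  · intro i hi
    obtain ⟨-, ha, hb, -⟩ := hx i hi
    have h2 : 0 < ((x i).2 + ℓ - u) / ℓ := div_pos (by linarith) hℓ
    simp only [F, f, Finset.coe_product, Set.mem_prod, Finset.coe_univ, Set.mem_univ, true_and,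
      Finset.mem_coe, Finset.mem_Icc]
    refine ⟨Nat.ceil_pos.mpr h2, Nat.ceil_le.mpr ?_⟩
    rw [div_le_iff₀ hℓ]
    linarith
  · intro i hi j hj hij
    simp only [f, Prod.mk.injEq] at hij
    obtain ⟨hp, hn⟩ := hij
    obtain ⟨si, hi1, -, hi3⟩ := hx i hi
    obtain ⟨sj, hj1, -, hj3⟩ := hx j hj
    have hgap : ∀ a b : ℝ, u < a + ℓ → ⌈(a + ℓ - u) / ℓ⌉₊ = ⌈(b + ℓ - u) / ℓ⌉₊ → u < b + ℓ →
        b < a + ℓ := by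
      intro a b ha hab hb
      have h4 : 0 < (a + ℓ - u) / ℓ := div_pos (by linarith) hℓ
      have h5 := Nat.ceil_lt_add_one h4.le
      have h6 := Nat.le_ceil ((b + ℓ - u) / ℓ)
      rw [← hab] at h6
      have h7 : (b + ℓ - u) / ℓ < (a + ℓ - u) / ℓ + 1 := h6.trans_lt h5
      rw [div_add_one hℓ.ne', div_lt_div_iff_of_pos_right hℓ] at h7
      linarith
    have key : ∀ a b : ℕ, a ∈ T → b ∈ T → (x a).1 = (x b).1 → (x b).2 < (x a).2 + ℓ →
        ¬ (x a).2 < (x b).2 := by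
      intro a b ha hb hab hlt hlt'
      obtain ⟨sa, -, -, ca⟩ := hx a ha
      obtain ⟨sb, -⟩ := hx b hb
      rw [← hab] at sb
      have := hS.add_size_le sa sb hlt' fun c hc hac => hlt.trans_le (ca c hc hac)
      rw [(hT a ha).1] at this
      linarith
    have h8 := key i j hi hj hp (hgap _ _ hi1 hn hj1)
    have h9 := key j i hj hi hp.symm (hgap _ _ hj1 hn.symm hi1)
    have h10 : (x i).2 = (x j).2 := le_antisymm (not_lt.mp h9) (not_lt.mp h8)
    rw [hp, h10, sj] at si
    exact (Option.some.inj si).symm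

/-! ### Queue positions and the absence of duplicate completions -/

theorem taskAt_eq_none_iff {L : Set ℕ} {k : ℕ} : taskAt L k = none ↔ L.ncard ≤ k := by
  unfold taskAt
  split_ifs with h
  · simpa using h
  · simpa using h

/-- The task at position `k` has exactly `k` predecessors. -/
theorem ncard_lt_of_taskAt {L : Set ℕ} {k i : ℕ} (hL : L.Finite) (h : taskAt L k = some i) :
    {j | j ∈ L ∧ j < i}.ncard = k := by
  classical
  unfold taskAt at h
  split_ifs at h with hk
  have h2 := Option.some.inj h
  have h3 : Nat.count (fun i => i ∈ L) i = k := by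
    rw [← h2]
    convert Nat.count_nth (p := fun i => i ∈ L) (n := k) ?_
    intro hf
    rwa [Set.ncard_eq_toFinset_card L hL] at hk
  rw [← h3, Nat.count_eq_card_filter_range, ← Set.ncard_coe_finset]
  congr 1
  ext j
  simp [and_comm]

/-- The cycle starting at time `t` is with the task at position `p m` of its queue. -/
def AtOwnPosition (A : ArrivalPattern P) (E : ErrorPattern P) (S : Schedule P) (p : Fin P.m)
    (t : ℝ) (i : ℕ) : Prop :=
  taskAt (queue A E S (A.size i) t) (p * P.m) = some i

/-- A task is executed to completion by at most one cycle with a task at position `p m`. -/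
theorem Legal.eq_of_atOwnPosition (hS : Legal A E S) {p q : Fin P.m} {s s' : ℝ} {i : ℕ}
    (hp : S p s = some i) (hq : S q s' = some i)
    (hcp : ∀ c ∈ E.crash p, s < c → s + A.size i ≤ c)
    (hcq : ∀ c ∈ E.crash q, s' < c → s' + A.size i ≤ c)
    (hpp : AtOwnPosition A E S p s i) (hqq : AtOwnPosition A E S q s' i) : p = q ∧ s = s' := by
  wlog hss : s ≤ s' generalizing p q s s'
  · have := this hq hp hcq hcp hqq hpp (not_le.mp hss).le
    exact ⟨this.1.symm, this.2.symm⟩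
  have hpend := (hS q s' i hq).2.2
  have hlt : s' < s + A.size i := by
    by_contra hle
    exact hpend.2.2 ⟨p, s, hp, not_lt.mp hle, hcp⟩
  by_cases hpq : p = q
  · refine ⟨hpq, ?_⟩
    by_contra hne
    subst hpq
    have := hS.add_size_le hp hq (lt_of_le_of_ne hss hne) fun c hc hsc =>
      hlt.trans_le (hcp c hc hsc)
    linarith
  exfalso
  have hpend0 := (hS p s i hp).2.2
  have hm := P.m_pos
  have n1 := ncard_lt_of_taskAt (queue_finite _ _) hpp
  have n2 := ncard_lt_of_taskAt (queue_finite _ _) hqq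
  set Q := {j | j ∈ queue A E S (A.size i) s ∧ j < i} with hQ
  set Q' := {j | j ∈ queue A E S (A.size i) s' ∧ j < i} with hQ'
  have hfin : Q.Finite := (queue_finite _ _).subset fun j hj => hj.1
  have hsub : Q' ⊆ Q := by
    rintro j ⟨⟨⟨h1, h2, h3⟩, h4⟩, h5⟩
    exact ⟨⟨⟨h1, (A.arr_mono j h1 i hpend.1 h5.le).trans hpend0.2.1,
      fun hc => h3 (hc.mono hss)⟩, h4⟩, h5⟩
  -- The set of predecessors of `i` can only shrink, since later arrivals come behind `i`. During
  -- the first cycle at most m tasks of this size are completed, and `i` is one of them, so fewer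
  -- than m predecessors disappear. Moving from position pm to a different qm would need at least m.
  have h1 : ((Q \ Q') ∪ {i}).ncard ≤ 1 * P.m := by
    refine hS.ncard_le_of_completed_between (u := s) (v := s + A.size i) (size_pos A i)
      (by simp) ?_
    rintro j (⟨hj, hj'⟩ | rfl)
    · refine ⟨hj.1.2, hj.1.1.2.2, ?_⟩
      by_contra hc
      exact hj' ⟨⟨⟨hj.1.1.1, hj.1.1.2.1.trans hss, fun h => hc (h.mono hlt.le)⟩, hj.1.2⟩, hj.2⟩
    · exact ⟨rfl, hpend0.2.2, p, s, hp, le_rfl, hcp⟩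
  rw [Set.union_singleton, Set.ncard_insert_of_notMem (fun h => lt_irrefl _ h.1.2)
    (hfin.subset Set.sdiff_subset)] at h1
  have h2 := Set.ncard_sdiff_add_ncard_of_subset hsub hfin
  rw [n1, n2] at h2
  have h3 : (q : ℕ) < p := by
    refine lt_of_le_of_ne ?_ fun h => hpq (Fin.ext h.symm)
    have : (q : ℕ) * P.m ≤ p * P.m := by omega
    exact Nat.le_of_mul_le_mul_right this hm
  have h4 : ((q : ℕ) + 1) * P.m ≤ p * P.m := Nat.mul_le_mul_right _ h3
  rw [add_mul] at h4
  omega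

/-! ### Decisions of the algorithm -/

theorem System.ℓmax_pos (P : System) : 0 < P.ℓmax := P.ℓmin_pos.trans P.ℓmin_lt_ℓmax

theorem System.rhoBar_mul_le (P : System) : (P.rhoBar : ℝ) * P.ℓmin ≤ P.ℓmax := by
  have h : (P.rhoBar : ℝ) ≤ P.ℓmax / P.ℓmin :=
    Nat.floor_le (div_pos P.ℓmax_pos P.ℓmin_pos).le
  rwa [le_div_iff₀ P.ℓmin_pos] at h

theorem System.one_le_rhoBar (P : System) : 1 ≤ P.rhoBar := by
  refine Nat.le_floor ?_
  rw [Nat.cast_one, System.rho, le_div_iff₀ P.ℓmin_pos, one_mul]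
  exact P.ℓmin_lt_ℓmax.le

theorem mul_lt_sq (p : Fin P.m) : (p : ℕ) * P.m < P.m ^ 2 := by
  rw [sq]
  exact Nat.mul_lt_mul_of_pos_right p.2 P.m_pos

theorem IsRun.eq_select (h : IsRun A E S) {p : Fin P.m} {r t : ℝ} (hr : E.AliveSince p r t)
    (hb : ¬ Busy A E S p t) : S p t = select A E S p t := by
  rw [h p t, decision, if_pos ⟨⟨r, hr⟩, hb⟩]

theorem inPreamble_iff {p : Fin P.m} {r t : ℝ} (hr : E.AliveSince p r t) :
    InPreamble A E S p t ↔
      PreambleFlag A E S p r t ∧ (startsIn S p r t).encard < (P.rhoBar : ℕ∞) := by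
  refine ⟨?_, fun h => ⟨r, hr, h⟩⟩
  rintro ⟨r', hr', h⟩
  rwa [aliveSince_unique hr hr']

/-- A machine whose first cycle after a restart starts at time `s`, with enough small tasks, executes
`⌊ρ⌋` small tasks in a row from time `s` on, as long as it does not crash. -/
theorem IsRun.preamble_cycles (h : IsRun A E S) {p : Fin P.m} {r s : ℝ}
    (hno : startsIn S p r s = ∅) (hs : S p s ≠ none) (hrs : r ≤ s) (hE : EnoughSmall A E S s)
    (i : ℕ) (hi : i < P.rhoBar) (hal : E.AliveSince p r (s + i * P.ℓmin)) :
    ∃ j, S p (s + i * P.ℓmin) = some j ∧ A.size j = P.ℓmin := by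
  induction i using Nat.strong_induction_on with
  | _ i ih =>
  have hp := P.ℓmin_pos
  have hal' : ∀ j ≤ i, E.AliveSince p r (s + j * P.ℓmin) := by
    intro j hj
    refine aliveSince_of_le hal ?_ (by gcongr)
    have : 0 ≤ (j : ℝ) * P.ℓmin := by positivity
    linarith
  -- By induction the cycles at s, s + ℓmin, … fill the time since `s` without gaps, so no start
  -- falls strictly between two of them.
  have hst : ∀ v ∈ startsIn S p r (s + i * P.ℓmin), ∃ j < i, v = s + (j : ℝ) * P.ℓmin := by
    rintro v ⟨hrv, hvt, hv⟩
    have hsv : s ≤ v := by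
      by_contra hlt
      have : v ∈ startsIn S p r s := ⟨hrv, not_le.mp hlt, hv⟩
      rw [hno] at this
      exact this
    have h0 : 0 ≤ (v - s) / P.ℓmin := div_nonneg (by linarith) hp.le
    have h1 : (⌊(v - s) / P.ℓmin⌋₊ : ℝ) * P.ℓmin ≤ v - s := by
      have := Nat.floor_le h0
      rwa [le_div_iff₀ hp] at this
    have h2 : v - s < ((⌊(v - s) / P.ℓmin⌋₊ : ℝ) + 1) * P.ℓmin := by
      have := Nat.lt_floor_add_one ((v - s) / P.ℓmin)
      rwa [div_lt_iff₀ hp] at this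
    have h3 : ⌊(v - s) / P.ℓmin⌋₊ < i := by
      rw [Nat.floor_lt h0, div_lt_iff₀ hp]
      linarith
    refine ⟨_, h3, ?_⟩
    obtain ⟨a, ha, hsz⟩ := ih _ h3 (h3.trans hi) (hal' _ h3.le)
    by_contra hne
    obtain ⟨b, hb⟩ := Option.ne_none_iff_exists'.mp hv
    have hlt := lt_of_le_of_ne (by linarith) (Ne.symm hne)
    have := h.legal.add_size_le ha hb hlt fun c hc hsc =>
      hvt.trans (hal.2.2 c hc ((hal' _ h3.le).2.1.trans_lt hsc))
    rw [hsz] at this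
    linarith
  have hnb : ¬ Busy A E S p (s + i * P.ℓmin) := by
    intro hb
    obtain ⟨v, a, hv, hrv, hvt, htv⟩ := h.legal.exists_cycle_of_busy hal hb
    obtain ⟨j, hj, rfl⟩ := hst v ⟨hrv, hvt, by simp [hv]⟩
    obtain ⟨b, hb, hsz⟩ := ih j hj (hj.trans hi) (hal' j hj.le)
    obtain rfl : b = a := Option.some.inj (hb.symm.trans hv)
    rw [hsz] at htv
    have : ((j : ℝ) + 1) * P.ℓmin ≤ i * P.ℓmin := by
      gcongr
      exact_mod_cast hj
    linarith
  have hpre : InPreamble A E S p (s + i * P.ℓmin) := by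
    rw [inPreamble_iff hal]
    constructor
    · rcases Nat.eq_zero_or_pos i with rfl | hpos
      · left
        simpa using ⟨hno, hE⟩
      · right
        refine ⟨s, ⟨⟨hrs, ?_, hs⟩, ?_⟩, hE⟩
        · have : 0 < (i : ℝ) * P.ℓmin := by positivity
          linarith
        · intro v hv
          obtain ⟨j, -, rfl⟩ := hst v hv
          have : 0 ≤ (j : ℝ) * P.ℓmin := by positivity
          linarith
    · have hsub : startsIn S p r (s + i * P.ℓmin) ⊆
          ((Finset.range i).image fun j : ℕ => s + (j : ℝ) * P.ℓmin : Finset ℝ) := by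
        intro v hv
        obtain ⟨j, hj, rfl⟩ := hst v hv
        simp only [Finset.coe_image, Set.mem_image, Finset.mem_coe, Finset.mem_range]
        exact ⟨j, hj, rfl⟩
      refine (Set.encard_le_encard hsub).trans_lt ?_
      rw [Set.encard_coe_eq_coe_finsetCard]
      have : ((Finset.range i).image fun j : ℕ => s + (j : ℝ) * P.ℓmin).card ≤ i :=
        Finset.card_image_le.trans (by simp)
      exact_mod_cast this.trans_lt hi
  -- At most i·m small tasks have left the queue since `s`, and i + 1 ≤ `rhoBar`, so at least (i +
  -- 1)m² - i·m ≥ m² remain.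
  have hcard : (p : ℕ) * P.m < (queue A E S P.ℓmin (s + i * P.ℓmin)).ncard := by
    have h1 : (queue A E S P.ℓmin s \ queue A E S P.ℓmin (s + i * P.ℓmin)).ncard ≤ i * P.m := by
      refine h.legal.ncard_le_of_completed_between (u := s) hp le_rfl ?_
      rintro j ⟨⟨⟨hj1, hj2, hj3⟩, hj4⟩, hj'⟩
      refine ⟨hj4, hj3, ?_⟩
      by_contra hc
      refine hj' ⟨⟨hj1, hj2.trans ?_, hc⟩, hj4⟩
      have : 0 ≤ (i : ℝ) * P.ℓmin := by positivity
      linarith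
    have h2 := Set.ncard_le_ncard_sdiff_add_ncard (queue A E S P.ℓmin s)
      (queue A E S P.ℓmin (s + i * P.ℓmin)) (queue_finite _ _)
    have h3 : P.rhoBar * P.m ^ 2 ≤ (queue A E S P.ℓmin s).ncard := hE
    have h4 : ((p : ℕ) + 1) * P.m ≤ P.m * P.m := Nat.mul_le_mul_right _ p.2
    have h5 : (i + 1) * P.m ^ 2 ≤ P.rhoBar * P.m ^ 2 := Nat.mul_le_mul_right _ hi
    have h6 : i * P.m ≤ i * P.m ^ 2 := Nat.mul_le_mul_left _ (Nat.le_self_pow two_ne_zero _)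
    have h7 := P.m_pos
    nlinarith
  have hsel := h.eq_select hal hnb
  rw [select, if_pos hpre] at hsel
  obtain ⟨j, hj⟩ := Option.ne_none_iff_exists'.mp
    (fun hn => (taskAt_eq_none_iff.mp hn).not_gt hcard)
  exact ⟨j, hsel.trans hj, (taskAt_mem hj).2⟩

/-- While one of the queues has at least `m²` tasks, no machine is idle. -/
theorem IsRun.start_of_not_busy (h : IsRun A E S) {p : Fin P.m} {r t : ℝ}
    (hal : E.AliveSince p r t) (hb : ¬ Busy A E S p t)
    (hq : P.m ^ 2 ≤ (queue A E S P.ℓmin t).ncard ∨ P.m ^ 2 ≤ (queue A E S P.ℓmax t).ncard) :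
    S p t ≠ none := by
  have hpm := mul_lt_sq p
  have hp := P.ℓmin_pos
  by_cases hpre : InPreamble A E S p t
  · obtain ⟨hflag, hrank⟩ := (inPreamble_iff hal).mp hpre
    rcases hflag with ⟨-, hE⟩ | ⟨s, ⟨⟨hrs, hst, hs⟩, hmin⟩, hE⟩
    · rw [h.eq_select hal hb, select, if_pos hpre, Ne, taskAt_eq_none_iff, not_le]
      have h1 : P.rhoBar * P.m ^ 2 ≤ (queue A E S P.ℓmin t).ncard := hE
      have h2 : 1 * P.m ^ 2 ≤ P.rhoBar * P.m ^ 2 := Nat.mul_le_mul_right _ P.one_le_rhoBar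
      omega
    · have hno : startsIn S p r s = ∅ := by
        rw [Set.eq_empty_iff_forall_notMem]
        rintro v ⟨h1, h2, h3⟩
        have := hmin ⟨h1, h2.trans hst, h3⟩
        linarith
      have hrun := h.preamble_cycles hno hs hrs hE
      have hal' : ∀ i : ℕ, s + i * P.ℓmin ≤ t → E.AliveSince p r (s + i * P.ℓmin) := by
        intro i hi
        refine aliveSince_of_le hal ?_ hi
        have : 0 ≤ (i : ℝ) * P.ℓmin := by positivity
        linarith
      have h0 : 0 ≤ (t - s) / P.ℓmin := div_nonneg (by linarith) hp.le
      -- The small queue may be short by now, so the test at `t` alone does not help. Slot `i` of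
      -- the preamble contains `t`: either it starts at `t`, or the machine is busy in it, or the
      -- preamble is already over.
      obtain ⟨i, hi⟩ : ∃ i, i = ⌊(t - s) / P.ℓmin⌋₊ := ⟨_, rfl⟩
      have h1 : (i : ℝ) * P.ℓmin ≤ t - s := by
        have := Nat.floor_le h0
        rwa [← hi, le_div_iff₀ hp] at this
      have h2 : t - s < ((i : ℝ) + 1) * P.ℓmin := by
        have := Nat.lt_floor_add_one ((t - s) / P.ℓmin)
        rwa [← hi, div_lt_iff₀ hp] at this
      rcases lt_or_ge i P.rhoBar with hik | hik
      · obtain ⟨j, hj, hsz⟩ := hrun i hik (hal' i (by linarith))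
        rcases eq_or_lt_of_le (show s + i * P.ℓmin ≤ t by linarith) with heq | hlt
        · rw [← heq, hj]
          exact Option.some_ne_none j
        · refine absurd ⟨_, j, hj, hlt, by rw [hsz]; linarith, fun c hc hsc => ?_⟩ hb
          exact hal.2.2 c hc ((hal' i (by linarith)).2.1.trans_lt hsc)
      · exfalso
        refine hrank.not_ge ?_
        have hsub : (((Finset.range P.rhoBar).image fun j : ℕ => s + (j : ℝ) * P.ℓmin : Finset ℝ) :
            Set ℝ) ⊆ startsIn S p r t := by
          intro v hv
          simp only [Finset.coe_image, Set.mem_image, Finset.mem_coe, Finset.mem_range] at hv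
          obtain ⟨j, hj, rfl⟩ := hv
          have h3 : ((j : ℝ) + 1) * P.ℓmin ≤ i * P.ℓmin := by
            gcongr
            exact_mod_cast lt_of_lt_of_le hj hik
          obtain ⟨a, ha, -⟩ := hrun j hj (hal' j (by linarith))
          exact ⟨(hal' j (by linarith)).2.1, by linarith, by simp [ha]⟩
        refine le_trans (le_of_eq ?_) (Set.encard_le_encard hsub)
        rw [Set.encard_coe_eq_coe_finsetCard, Finset.card_image_of_injective, Finset.card_range]
        intro a b hab
        simpa [hp.ne'] using hab
  · rw [h.eq_select hal hb, select, if_neg hpre]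
    split_ifs with h1 h2
    · rw [Ne, taskAt_eq_none_iff]
      omega
    · rw [Ne, taskAt_eq_none_iff]
      omega
    · omega
    · omega
    · omega

/-- The positions modulo the length of a queue are used only when both queues are short. -/
theorem IsRun.atOwnPosition (h : IsRun A E S) {p : Fin P.m} {t : ℝ} {i : ℕ}
    (hi : S p t = some i)
    (hq : P.m ^ 2 ≤ (queue A E S P.ℓmin t).ncard ∨ P.m ^ 2 ≤ (queue A E S P.ℓmax t).ncard) :
    AtOwnPosition A E S p t i := by
  obtain ⟨⟨r, hr⟩, hb, -⟩ := h.legal p t i hi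
  rw [h.eq_select hr hb, select] at hi
  have key : ∀ ℓ, taskAt (queue A E S ℓ t) (p * P.m) = some i → AtOwnPosition A E S p t i := by
    intro ℓ hk
    have := (taskAt_mem hk).2
    rw [AtOwnPosition, this]
    exact hk
  split_ifs at hi with h1 h2 h3
  · exact key _ hi
  · exact key _ hi
  · exact key _ hi
  all_goals omega

/-- While the queue of the large tasks is long, small tasks are started in the preamble only. -/
theorem IsRun.inPreamble_of_small (h : IsRun A E S) {p : Fin P.m} {t : ℝ} {i : ℕ}
    (hi : S p t = some i) (hsz : A.size i = P.ℓmin)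
    (hq : P.m ^ 2 ≤ (queue A E S P.ℓmax t).ncard) : InPreamble A E S p t := by
  obtain ⟨⟨r, hr⟩, hb, -⟩ := h.legal p t i hi
  by_contra hpre
  rw [h.eq_select hr hb, select, if_neg hpre] at hi
  rw [if_pos hq] at hi
  have := (taskAt_mem hi).2
  have := P.ℓmin_lt_ℓmax
  linarith

/-! ### Lengths of covering and of disjoint intervals -/

theorem sub_le_sum_of_cover {Z : Finset ℝ} {d : ℝ → ℝ} {b e : ℝ} (hd : ∀ s ∈ Z, 0 ≤ d s)
    (h : ∀ v, b ≤ v → v < e → ∃ s ∈ Z, s ≤ v ∧ v < s + d s) : e - b ≤ ∑ s ∈ Z, d s := by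
  have h1 : Ico b e ⊆ ⋃ s ∈ Z, Ico s (s + d s) := by
    intro v hv
    obtain ⟨s, hs, hsv⟩ := h v hv.1 hv.2
    exact Set.mem_biUnion hs hsv
  have h2 := (MeasureTheory.measure_mono (μ := MeasureTheory.volume) h1).trans
    (MeasureTheory.measure_biUnion_finset_le Z _)
  simp only [Real.volume_Ico, add_sub_cancel_left] at h2
  rw [← ENNReal.ofReal_sum_of_nonneg hd] at h2
  exact (ENNReal.ofReal_le_ofReal_iff (Finset.sum_nonneg hd)).mp h2

theorem sum_le_sub_of_disjoint {Z : Finset ℝ} {d : ℝ → ℝ} {b e : ℝ} (hbe : b ≤ e)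
    (hb : ∀ s ∈ Z, b ≤ s) (he : ∀ s ∈ Z, s + d s ≤ e)
    (h : ∀ s ∈ Z, ∀ s' ∈ Z, s < s' → s + d s ≤ s') : ∑ s ∈ Z, d s ≤ e - b := by
  induction Z using Finset.induction_on_max generalizing e with
  | empty => simpa using hbe
  | insert a Z ha ih =>
    rw [Finset.sum_insert fun hm => lt_irrefl a (ha a hm)]
    have h1 := ih (e := a) (hb a (Finset.mem_insert_self _ _))
      (fun s hs => hb s (Finset.mem_insert_of_mem hs))
      (fun s hs => h s (Finset.mem_insert_of_mem hs) a (Finset.mem_insert_self _ _) (ha s hs))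
      (fun s hs s' hs' => h s (Finset.mem_insert_of_mem hs) s' (Finset.mem_insert_of_mem hs'))
    have h2 := he a (Finset.mem_insert_self _ _)
    linarith


/-! ### The load completed in one phase -/

theorem size_le_ℓmax (A : ArrivalPattern P) (i : ℕ) : A.size i ≤ P.ℓmax := by
  rcases A.size_mem i with h | h <;> rw [h]
  exact P.ℓmin_lt_ℓmax.le

/-- The length of the cycle that machine `p` starts at time `s`, and `0` if there is none. -/
def dur (A : ArrivalPattern P) (S : Schedule P) (p : Fin P.m) (s : ℝ) : ℝ :=
  (S p s).elim 0 A.size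

theorem dur_of_some {p : Fin P.m} {s : ℝ} {i : ℕ} (h : S p s = some i) :
    dur A S p s = A.size i := by simp [dur, h]

theorem exists_of_dur_pos {p : Fin P.m} {s : ℝ} (h : 0 < dur A S p s) :
    ∃ i, S p s = some i ∧ A.size i = dur A S p s := by
  cases hs : S p s with
  | none => simp [dur, hs] at h
  | some i => exact ⟨i, rfl, (dur_of_some hs).symm⟩

theorem dur_nonneg (p : Fin P.m) (s : ℝ) : 0 ≤ dur A S p s := by
  cases hs : S p s with
  | none => simp [dur, hs]
  | some i => rw [dur_of_some hs]; exact (size_pos A i).le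

theorem dur_le (p : Fin P.m) (s : ℝ) : dur A S p s ≤ P.ℓmax := by
  cases hs : S p s with
  | none => simpa [dur, hs] using P.ℓmax_pos.le
  | some i => rw [dur_of_some hs]; exact size_le_ℓmax A i

/-- The end of the phase that begins with the restart at time `r`: the next crash, or the horizon `T`
if that comes first. -/
def phaseEnd (E : ErrorPattern P) (p : Fin P.m) (r T : ℝ) : ℝ :=
  sInf (insert T {c | c ∈ E.crash p ∧ r < c})

section phaseEnd

variable {p : Fin P.m} {r T v : ℝ}

theorem phaseEnd_bddBelow : BddBelow (insert T {c | c ∈ E.crash p ∧ r < c}) :=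
  BddBelow.insert T ⟨r, fun _ hc => hc.2.le⟩

theorem phaseEnd_le : phaseEnd E p r T ≤ T := csInf_le phaseEnd_bddBelow (mem_insert _ _)

theorem phaseEnd_le_crash {c : ℝ} (hc : c ∈ E.crash p) (hrc : r < c) : phaseEnd E p r T ≤ c :=
  csInf_le phaseEnd_bddBelow (mem_insert_of_mem _ ⟨hc, hrc⟩)

theorem le_phaseEnd (hv : v ≤ T) (h : ∀ c ∈ E.crash p, r < c → v ≤ c) :
    v ≤ phaseEnd E p r T := by
  refine le_csInf (insert_nonempty _ _) ?_
  rintro c (rfl | hc)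
  · exact hv
  · exact h c hc.1 hc.2

theorem aliveSince_of_lt_phaseEnd (hr : r ∈ E.restart p) (hv : r ≤ v)
    (h : v < phaseEnd E p r T) : E.AliveSince p r v :=
  ⟨hr, hv, fun _ hc hrc => h.trans_le (phaseEnd_le_crash hc hrc)⟩

end phaseEnd

/-- The starting times after `w` of the cycles of length `ℓ` that machine `p` completes in the
phase from `r` to `e`. -/
def cycles (A : ArrivalPattern P) (S : Schedule P) (p : Fin P.m) (r e w ℓ : ℝ) : Set ℝ :=
  {s | r ≤ s ∧ w < s ∧ s + ℓ ≤ e ∧ dur A S p s = ℓ}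

section Phase

variable {p : Fin P.m} {r w T : ℝ}

theorem Legal.add_dur_le (hS : Legal A E S) {s s' : ℝ} (hr : r ≤ s) (hss : s < s')
    (he : s' < phaseEnd E p r T) (hs' : S p s' ≠ none) : s + dur A S p s ≤ s' := by
  cases hs : S p s with
  | none => simpa [dur, hs] using hss.le
  | some i =>
    obtain ⟨j, hj⟩ := Option.ne_none_iff_exists'.mp hs'
    rw [dur_of_some hs]
    exact hS.add_size_le hs hj hss fun c hc hsc =>
      he.trans_le (phaseEnd_le_crash hc (hr.trans_lt hsc))

/-- Starts in one phase are at least ℓmin apart, so they fall into different slots of that length.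
-/
theorem Legal.finite_starts (hS : Legal A E S) :
    {s | r ≤ s ∧ s < phaseEnd E p r T ∧ S p s ≠ none}.Finite := by
  have hp := P.ℓmin_pos
  refine Set.Finite.of_finite_image (f := fun s => ⌊(s - r) / P.ℓmin⌋₊)
    ((Set.finite_Iic ⌊(phaseEnd E p r T - r) / P.ℓmin⌋₊).subset ?_) ?_
  · rintro _ ⟨s, ⟨-, hs, -⟩, rfl⟩
    exact Nat.floor_le_floor (by gcongr)
  · intro s hs s' hs' heq
    by_contra hne
    wlog hlt : s < s' generalizing s s'
    · exact this hs' hs heq.symm (Ne.symm hne) (lt_of_le_of_ne (not_lt.mp hlt) (Ne.symm hne))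
    have h1 := hS.add_dur_le hs.1 hlt hs'.2.1 hs'.2.2
    obtain ⟨i, hi⟩ := Option.ne_none_iff_exists'.mp hs.2.2
    rw [dur_of_some hi] at h1
    have h2 := ℓmin_le_size A i
    have h3 := Nat.lt_floor_add_one ((s' - r) / P.ℓmin)
    have h4 := Nat.floor_le (div_nonneg (sub_nonneg.mpr hs.1) hp.le : 0 ≤ (s - r) / P.ℓmin)
    have heq' : ⌊(s - r) / P.ℓmin⌋₊ = ⌊(s' - r) / P.ℓmin⌋₊ := heq
    rw [← heq'] at h3
    have h5 := h3.trans_le (add_le_add_left h4 1)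
    rw [div_add_one hp.ne', div_lt_div_iff_of_pos_right hp] at h5
    linarith

theorem cycles_subset_starts {ℓ e : ℝ} (hℓ : 0 < ℓ) :
    cycles A S p r e w ℓ ⊆ {s | r ≤ s ∧ s < e ∧ S p s ≠ none} := by
  rintro s ⟨h1, -, h3, h4⟩
  obtain ⟨i, hi, -⟩ := exists_of_dur_pos (A := A) (h4 ▸ hℓ)
  exact ⟨h1, by linarith, by simp [hi]⟩

theorem Legal.finite_cycles (hS : Legal A E S) {ℓ : ℝ} (hℓ : 0 < ℓ) :
    (cycles A S p r (phaseEnd E p r T) w ℓ).Finite :=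
  hS.finite_starts.subset (cycles_subset_starts hℓ)

theorem sum_dur {U V : Set ℝ} (hU : U.Finite) (hV : V.Finite) (hU' : ∀ s ∈ U, dur A S p s = P.ℓmin)
    (hV' : ∀ s ∈ V, dur A S p s = P.ℓmax) :
    ∑ s ∈ hU.toFinset ∪ hV.toFinset, dur A S p s = P.ℓmin * U.ncard + P.ℓmax * V.ncard := by
  rw [Finset.sum_union, Finset.sum_congr rfl (g := fun _ => P.ℓmin),
    Finset.sum_congr rfl (s₁ := hV.toFinset) (g := fun _ => P.ℓmax)]
  · rw [Finset.sum_const, Finset.sum_const, Set.ncard_eq_toFinset_card U hU,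
      Set.ncard_eq_toFinset_card V hV, nsmul_eq_mul, nsmul_eq_mul, mul_comm, mul_comm P.ℓmax]
  · exact fun s hs => hV' s (by simpa using hs)
  · exact fun s hs => hU' s (by simpa using hs)
  · rw [Finset.disjoint_left]
    intro s hs hs'
    have h1 := hU' s (by simpa using hs)
    have h2 := hV' s (by simpa using hs')
    have := P.ℓmin_lt_ℓmax
    linarith

/-- The load completed in a phase is at most the length of the phase. -/
theorem Legal.load_le (hS : Legal A E S) {w' b : ℝ} (hbe : b ≤ phaseEnd E p r T)
    (hb : b ≤ r ∨ b ≤ w ∧ b ≤ w') :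
    P.ℓmin * (cycles A S p r (phaseEnd E p r T) w P.ℓmin).ncard +
      P.ℓmax * (cycles A S p r (phaseEnd E p r T) w' P.ℓmax).ncard ≤ phaseEnd E p r T - b := by
  have f1 := hS.finite_cycles (p := p) (r := r) (w := w) (T := T) P.ℓmin_pos
  have f2 := hS.finite_cycles (p := p) (r := r) (w := w') (T := T) P.ℓmax_pos
  rw [← sum_dur (A := A) (S := S) (p := p) f1 f2 (fun s hs => hs.2.2.2) (fun s hs => hs.2.2.2)]
  have hmem : ∀ s ∈ f1.toFinset ∪ f2.toFinset, r ≤ s ∧ b ≤ s ∧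
      s + dur A S p s ≤ phaseEnd E p r T ∧ s < phaseEnd E p r T ∧ S p s ≠ none := by
    intro s hs
    rw [Finset.mem_union, Set.Finite.mem_toFinset, Set.Finite.mem_toFinset] at hs
    rcases hs with hs | hs
    · refine ⟨hs.1, ?_, by rw [hs.2.2.2]; exact hs.2.2.1, (cycles_subset_starts P.ℓmin_pos hs).2⟩
      rcases hb with hb | hb
      · exact hb.trans hs.1
      · exact hb.1.trans hs.2.1.le
    · refine ⟨hs.1, ?_, by rw [hs.2.2.2]; exact hs.2.2.1, (cycles_subset_starts P.ℓmax_pos hs).2⟩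
      rcases hb with hb | hb
      · exact hb.trans hs.1
      · exact hb.2.trans hs.2.1.le
  exact sum_le_sub_of_disjoint hbe (fun s hs => (hmem s hs).2.1) (fun s hs => (hmem s hs).2.2.1)
    fun s hs s' hs' hlt => hS.add_dur_le (hmem s hs).1 hlt (hmem s' hs').2.2.2.1
      (hmem s' hs').2.2.2.2

/-- In the time window `(w, T]` one of the two queues is always long. -/
def LongQueue (A : ArrivalPattern P) (E : ErrorPattern P) (S : Schedule P) (w T : ℝ) : Prop :=
  ∀ v, w < v → v ≤ T →
    P.m ^ 2 ≤ (queue A E S P.ℓmin v).ncard ∨ P.m ^ 2 ≤ (queue A E S P.ℓmax v).ncard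

/-- The load completed in a phase is at least the length of the phase, but for one large task. -/
theorem IsRun.lt_load (h : IsRun A E S) (hq : LongQueue A E S w T) (hr : r ∈ E.restart p) {b : ℝ}
    (hrb : r ≤ b) (hwb : w < b) (hb : b = r ∨ w + P.ℓmax ≤ b) :
    phaseEnd E p r T - b - P.ℓmax <
      P.ℓmin * (cycles A S p r (phaseEnd E p r T) w P.ℓmin).ncard +
        P.ℓmax * (cycles A S p r (phaseEnd E p r T) w P.ℓmax).ncard := by
  have f1 := h.legal.finite_cycles (p := p) (r := r) (w := w) (T := T) P.ℓmin_pos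
  have f2 := h.legal.finite_cycles (p := p) (r := r) (w := w) (T := T) P.ℓmax_pos
  rw [← sum_dur (A := A) (S := S) (p := p) f1 f2 (fun s hs => hs.2.2.2) (fun s hs => hs.2.2.2)]
  have hcov : ∀ v, b ≤ v → v < phaseEnd E p r T →
      ∃ s, r ≤ s ∧ w < s ∧ s ≤ v ∧ v < s + dur A S p s := by
    intro v hbv hve
    have hal := aliveSince_of_lt_phaseEnd hr (hrb.trans hbv) hve
    by_cases hbusy : Busy A E S p v
    · obtain ⟨s, i, hs, hrs, hsv, hvs⟩ := h.legal.exists_cycle_of_busy hal hbusy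
      refine ⟨s, hrs, ?_, hsv.le, by rwa [dur_of_some hs]⟩
      rcases hb with rfl | hb
      · exact hwb.trans_le hrs
      · have := size_le_ℓmax A i
        linarith
    · have hne := h.start_of_not_busy hal hbusy
        (hq v (hwb.trans_le hbv) (hve.le.trans phaseEnd_le))
      obtain ⟨i, hi⟩ := Option.ne_none_iff_exists'.mp hne
      refine ⟨v, hrb.trans hbv, hwb.trans_le hbv, le_rfl, ?_⟩
      rw [dur_of_some hi]
      have := size_pos A i
      linarith
  have hmem : ∀ s v, r ≤ s → w < s → s ≤ v → v < s + dur A S p s →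
      s + dur A S p s ≤ phaseEnd E p r T → s ∈ f1.toFinset ∪ f2.toFinset := by
    intro s v hrs hws hsv hvs hse
    obtain ⟨i, -, hi⟩ := exists_of_dur_pos (A := A) (S := S) (p := p) (s := s) (by linarith)
    rw [Finset.mem_union, Set.Finite.mem_toFinset, Set.Finite.mem_toFinset]
    rcases A.size_mem i with hsz | hsz
    · left
      rw [← hsz, hi]
      exact ⟨hrs, hws, hse, rfl⟩
    · right
      rw [← hsz, hi]
      exact ⟨hrs, hws, hse, rfl⟩
  have hpos := P.ℓmax_pos
  -- Either every relevant cycle ends within the phase and these cycles cover it, or the cycle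
  -- starting at some `a` is cut off. In the second case the completed cycles still cover the time
  -- from `b` to `a`, and less than ℓmax is left after `a`. The strict inequality is needed later
  -- for rounding task counts.
  by_cases hall : ∀ s v, r ≤ s → w < s → s ≤ v → v < s + dur A S p s → v < phaseEnd E p r T →
      s + dur A S p s ≤ phaseEnd E p r T
  · have := sub_le_sum_of_cover (Z := f1.toFinset ∪ f2.toFinset) (d := dur A S p) (b := b)
      (e := phaseEnd E p r T) (fun s _ => dur_nonneg p s) fun v hbv hve => by
        obtain ⟨s, h1, h2, h3, h4⟩ := hcov v hbv hve
        exact ⟨s, hmem s v h1 h2 h3 h4 (hall s v h1 h2 h3 h4 hve), h3, h4⟩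
    linarith
  · push Not at hall
    obtain ⟨a, u, ha1, ha2, ha3, ha4, hue, hae⟩ := hall
    have hane : S p a ≠ none := by
      obtain ⟨i, hi, -⟩ := exists_of_dur_pos (A := A) (S := S) (p := p) (s := a) (by linarith)
      simp [hi]
    have hae' : a < phaseEnd E p r T := ha3.trans_lt hue
    have := sub_le_sum_of_cover (Z := f1.toFinset ∪ f2.toFinset) (d := dur A S p) (b := b)
      (e := a) (fun s _ => dur_nonneg p s) fun v hbv hva => by
        obtain ⟨s, h1, h2, h3, h4⟩ := hcov v hbv (hva.trans hae')
        have := h.legal.add_dur_le h1 (h3.trans_lt hva) hae' hane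
        exact ⟨s, hmem s v h1 h2 h3 h4 (this.trans hae'.le), h3, h4⟩
    have := dur_le (A := A) (S := S) p a
    linarith

theorem IsRun.start_restart (h : IsRun A E S) (hq : LongQueue A E S w T) (hr : r ∈ E.restart p)
    (hwr : w < r) (hre : r < phaseEnd E p r T) : S p r ≠ none :=
  h.start_of_not_busy (aliveSince_of_lt_phaseEnd hr le_rfl hre)
    (h.legal.not_busy_restart (aliveSince_of_lt_phaseEnd hr le_rfl hre))
    (hq r hwr (hre.le.trans phaseEnd_le))

/-- No machine idles, so the preamble begins at the restart itself and completes as many small tasks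
as fit, up to `rhoBar`. -/
theorem IsRun.le_ncard_of_enoughSmall (h : IsRun A E S) (hq : LongQueue A E S w T)
    (hr : r ∈ E.restart p) (hwr : w < r) (hE : EnoughSmall A E S r) {j : ℕ} (hj : j ≤ P.rhoBar)
    (hje : j * P.ℓmin ≤ phaseEnd E p r T - r) :
    j ≤ (cycles A S p r (phaseEnd E p r T) w P.ℓmin).ncard := by
  have hp := P.ℓmin_pos
  rcases Nat.eq_zero_or_pos j with rfl | hj0
  · exact Nat.zero_le _
  have hje' : ∀ i < j, r + i * P.ℓmin + P.ℓmin ≤ phaseEnd E p r T := by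
    intro i hi
    have : ((i : ℝ) + 1) * P.ℓmin ≤ j * P.ℓmin := by
      gcongr
      exact_mod_cast hi
    linarith
  have hre : r < phaseEnd E p r T := by
    have := hje' 0 hj0
    simp only [Nat.cast_zero, zero_mul] at this
    linarith
  have hno : startsIn S p r r = ∅ := by
    rw [Set.eq_empty_iff_forall_notMem]
    rintro v ⟨h1, h2, -⟩
    linarith
  have hrun := h.preamble_cycles hno (h.start_restart hq hr hwr hre) le_rfl hE
  have hsub : (((Finset.range j).image fun i : ℕ => r + (i : ℝ) * P.ℓmin : Finset ℝ) : Set ℝ) ⊆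
      cycles A S p r (phaseEnd E p r T) w P.ℓmin := by
    intro v hv
    simp only [Finset.coe_image, Set.mem_image, Finset.mem_coe, Finset.mem_range] at hv
    obtain ⟨i, hi, rfl⟩ := hv
    have h0 : 0 ≤ (i : ℝ) * P.ℓmin := by positivity
    have h1 := hje' i hi
    obtain ⟨a, ha, hsz⟩ := hrun i (hi.trans_le hj)
      (aliveSince_of_lt_phaseEnd (T := T) hr (by linarith) (by linarith))
    exact ⟨by linarith, by linarith, h1, by rw [dur_of_some ha, hsz]⟩
  have h2 := Set.ncard_le_ncard hsub (h.legal.finite_cycles hp)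
  rwa [Set.ncard_coe_finset, Finset.card_image_of_injective, Finset.card_range] at h2
  intro a b hab
  simpa [hp.ne'] using hab

theorem IsRun.inPreamble_of_mem_cycles (h : IsRun A E S)
    (hq : ∀ v, w < v → v ≤ T → P.m ^ 2 ≤ (queue A E S P.ℓmax v).ncard) {s : ℝ}
    (hs : s ∈ cycles A S p r (phaseEnd E p r T) w P.ℓmin) : InPreamble A E S p s := by
  have hp := P.ℓmin_pos
  obtain ⟨i, hi, hsz⟩ := exists_of_dur_pos (A := A) (hs.2.2.2 ▸ hp)
  refine h.inPreamble_of_small hi (hsz.trans hs.2.2.2) (hq s hs.2.1 ?_)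
  exact (cycles_subset_starts hp hs).2.1.le.trans phaseEnd_le

/-- The last small cycle still belongs to the preamble, so fewer than `rhoBar` cycles precede it in
the phase. -/
theorem IsRun.ncard_small_le (h : IsRun A E S) (hr : r ∈ E.restart p)
    (hq : ∀ v, w < v → v ≤ T → P.m ^ 2 ≤ (queue A E S P.ℓmax v).ncard) :
    (cycles A S p r (phaseEnd E p r T) w P.ℓmin).ncard ≤ P.rhoBar := by
  have hfin := h.legal.finite_cycles (p := p) (r := r) (w := w) (T := T) P.ℓmin_pos
  rcases (cycles A S p r (phaseEnd E p r T) w P.ℓmin).eq_empty_or_nonempty with he | hne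
  · simp [he]
  obtain ⟨s, hs, hmax⟩ := hfin.exists_maximalFor id _ hne
  have hse := (cycles_subset_starts P.ℓmin_pos hs).2.1
  have hal := aliveSince_of_lt_phaseEnd hr hs.1 hse
  have h1 := ((inPreamble_iff hal).mp (h.inPreamble_of_mem_cycles hq hs)).2
  have hsub : cycles A S p r (phaseEnd E p r T) w P.ℓmin \ {s} ⊆ startsIn S p r s := by
    rintro v ⟨hv, hvs⟩
    have hv' := cycles_subset_starts P.ℓmin_pos hv
    refine ⟨hv.1, ?_, hv'.2.2⟩
    rcases le_total s v with hle | hle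
    · exact absurd (le_antisymm (hmax hv hle) hle) hvs
    · exact lt_of_le_of_ne hle hvs
  have h2 := (Set.encard_le_encard hsub).trans_lt h1
  rw [← (hfin.subset Set.sdiff_subset).cast_ncard_eq] at h2
  have h3 : (cycles A S p r (phaseEnd E p r T) w P.ℓmin \ {s}).ncard < P.rhoBar := by
    exact_mod_cast h2
  rw [← Set.ncard_sdiff_singleton_add_one hs hfin]
  exact h3

/-- The first cycle starts at `r`, so the flag is fixed there, and it is false. -/
theorem IsRun.cycles_small_eq_empty (h : IsRun A E S) (hr : r ∈ E.restart p) (hwr : w < r)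
    (hq : ∀ v, w < v → v ≤ T → P.m ^ 2 ≤ (queue A E S P.ℓmax v).ncard)
    (hE : ¬ EnoughSmall A E S r) : cycles A S p r (phaseEnd E p r T) w P.ℓmin = ∅ := by
  rw [Set.eq_empty_iff_forall_notMem]
  intro s hs
  have hse := (cycles_subset_starts P.ℓmin_pos hs).2.1
  have hal := aliveSince_of_lt_phaseEnd hr hs.1 hse
  have hstart := h.start_restart (T := T) (fun v hv hv' => Or.inr (hq v hv hv')) hr hwr
    (hs.1.trans_lt hse)
  rcases ((inPreamble_iff hal).mp (h.inPreamble_of_mem_cycles hq hs)).1 with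
    ⟨hno, hE'⟩ | ⟨s', hs', hE'⟩
  · rcases eq_or_lt_of_le hs.1 with rfl | hlt
    · exact hE hE'
    · have : r ∈ startsIn S p r s := ⟨le_rfl, hlt, hstart⟩
      rw [hno] at this
      exact this
  · have hlt : r < s := hs'.1.1.trans_lt hs'.1.2.1
    obtain rfl : s' = r := le_antisymm (hs'.2 ⟨le_rfl, hlt, hstart⟩) hs'.1.1
    exact hE hE'

end Phase

/-! ### Completed tasks as sums over phases -/

variable {Y : Schedule P}

/-- The tasks of size `ℓ` completed by time `t`. -/
def doneTasks (A : ArrivalPattern P) (E : ErrorPattern P) (S : Schedule P) (ℓ t : ℝ) : Set ℕ :=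
  {i | A.size i = ℓ ∧ Completed A E S t i}

theorem Legal.finite_doneTasks (hS : Legal A E S) (ℓ t : ℝ) : (doneTasks A E S ℓ t).Finite :=
  (A.finite_arr t).subset fun _ hi => hS.mem_of_completed hi.2

theorem Legal.ncard_doneTasks_mono (hS : Legal A E S) {ℓ t u : ℝ} (htu : t ≤ u) :
    (doneTasks A E S ℓ t).ncard ≤ (doneTasks A E S ℓ u).ncard :=
  Set.ncard_le_ncard (fun _ hi => ⟨hi.1, hi.2.mono htu⟩) (hS.finite_doneTasks ℓ u)

theorem Legal.completedLoad_eq (hS : Legal A E S) (t : ℝ) :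
    completedLoad A E S t = P.ℓmin * (doneTasks A E S P.ℓmin t).ncard +
      P.ℓmax * (doneTasks A E S P.ℓmax t).ncard := by
  classical
  have f1 := hS.finite_doneTasks P.ℓmin t
  have f2 := hS.finite_doneTasks P.ℓmax t
  have hU : {i ∈ (A.finite_arr t).toFinset | Completed A E S t i} =
      f1.toFinset ∪ f2.toFinset := by
    ext i
    simp only [Finset.mem_filter, Set.Finite.mem_toFinset, Finset.mem_union, doneTasks,
      mem_ofPred_eq]
    constructor
    · rintro ⟨-, h⟩
      exact (A.size_mem i).imp (fun hs => ⟨hs, h⟩) fun hs => ⟨hs, h⟩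
    · rintro (⟨-, h⟩ | ⟨-, h⟩) <;> exact ⟨hS.mem_of_completed h, h⟩
  have hdisj : Disjoint f1.toFinset f2.toFinset := by
    rw [Finset.disjoint_left]
    intro i h1 h2
    have h3 := ((Set.Finite.mem_toFinset f1).mp h1).1
    have h4 := ((Set.Finite.mem_toFinset f2).mp h2).1
    have := P.ℓmin_lt_ℓmax
    linarith
  unfold completedLoad
  have hU' : (@Finset.filter ℕ (fun i => Completed A E S t i)
      (fun _ => Classical.propDecidable _) (A.finite_arr t).toFinset) =
      f1.toFinset ∪ f2.toFinset := by
    rw [← hU]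
  rw [hU', Finset.sum_union hdisj, Finset.sum_congr rfl (g := fun _ => P.ℓmin),
    Finset.sum_congr rfl (s₁ := f2.toFinset) (g := fun _ => P.ℓmax)]
  · rw [Finset.sum_const, Finset.sum_const, Set.ncard_eq_toFinset_card _ f1,
      Set.ncard_eq_toFinset_card _ f2, nsmul_eq_mul, nsmul_eq_mul, mul_comm, mul_comm P.ℓmax]
  · exact fun i hi => ((Set.Finite.mem_toFinset f2).mp hi).1
  · exact fun i hi => ((Set.Finite.mem_toFinset f1).mp hi).1

/-- The restarts of machine `p` by time `T`. -/
def restarts (E : ErrorPattern P) (p : Fin P.m) (T : ℝ) : Finset ℝ := (E.finite_restart p T).toFinset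

theorem mem_restarts {p : Fin P.m} {T r : ℝ} : r ∈ restarts E p T ↔ r ∈ E.restart p ∧ r ≤ T := by
  simp [restarts]

/-- Every task completed after `w` has a completing cycle that starts after w - ℓ. Duplicate
executions only enlarge the right-hand side. -/
theorem Legal.ncard_doneTasks_le (hY : Legal A E Y) {ℓ : ℝ} (hℓ : 0 < ℓ) (w T : ℝ) :
    (doneTasks A E Y ℓ T).ncard ≤ (doneTasks A E Y ℓ w).ncard +
      ∑ p, ∑ r ∈ restarts E p T, (cycles A Y p r (phaseEnd E p r T) (w - ℓ) ℓ).ncard := by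
  classical
  have hfin : ∀ p r, (cycles A Y p r (phaseEnd E p r T) (w - ℓ) ℓ).Finite := fun p r =>
    hY.finite_cycles hℓ
  let F : Finset ℕ := Finset.univ.biUnion fun p => (restarts E p T).biUnion fun r =>
    (hfin p r).toFinset.image fun s => (Y p s).getD 0
  have hF : F.card ≤
      ∑ p, ∑ r ∈ restarts E p T, (cycles A Y p r (phaseEnd E p r T) (w - ℓ) ℓ).ncard := by
    refine Finset.card_biUnion_le.trans (Finset.sum_le_sum fun p _ => ?_)
    refine Finset.card_biUnion_le.trans (Finset.sum_le_sum fun r _ => ?_)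
    rw [Set.ncard_eq_toFinset_card _ (hfin p r)]
    exact Finset.card_image_le
  have hsub : doneTasks A E Y ℓ T ⊆ doneTasks A E Y ℓ w ∪ (F : Set ℕ) := by
    rintro i ⟨hsz, p, s, hs, hsT, hc⟩
    rw [hsz] at hsT hc
    rcases le_or_gt (s + ℓ) w with hle | hlt
    · exact Or.inl ⟨hsz, p, s, hs, by rwa [hsz], by rwa [hsz]⟩
    right
    obtain ⟨⟨r, hr⟩, -⟩ := hY p s i hs
    rw [Finset.mem_coe, Finset.mem_biUnion]
    refine ⟨p, Finset.mem_univ p, ?_⟩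
    rw [Finset.mem_biUnion]
    refine ⟨r, mem_restarts.mpr ⟨hr.1, hr.2.1.trans (by linarith)⟩, ?_⟩
    rw [Finset.mem_image]
    refine ⟨s, ?_, by simp [hs]⟩
    rw [Set.Finite.mem_toFinset]
    exact ⟨hr.2.1, by linarith, le_phaseEnd hsT fun c hcc hrc => hc c hcc (hr.2.2 c hcc hrc),
      by rw [dur_of_some hs, hsz]⟩
  have h1 := Set.ncard_le_ncard hsub ((hY.finite_doneTasks ℓ w).union F.finite_toSet)
  have h2 := Set.ncard_union_le (doneTasks A E Y ℓ w) (F : Set ℕ)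
  rw [Set.ncard_coe_finset] at h2
  omega

/-- Here duplicates would hurt. They are excluded because each cycle started after `w` takes the
task at its own position. -/
theorem IsRun.le_ncard_doneTasks (h : IsRun A E S) {ℓ w T : ℝ} (hℓ : 0 < ℓ) (hwT : w ≤ T)
    (hq : LongQueue A E S w T) :
    (doneTasks A E S ℓ w).ncard +
      ∑ p, ∑ r ∈ restarts E p T, (cycles A S p r (phaseEnd E p r T) w ℓ).ncard ≤
    (doneTasks A E S ℓ T).ncard := by
  classical
  have hfin : ∀ p r, (cycles A S p r (phaseEnd E p r T) w ℓ).Finite := fun p r =>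
    h.legal.finite_cycles hℓ
  have hsub : doneTasks A E S ℓ w ⊆ doneTasks A E S ℓ T := fun i hi => ⟨hi.1, hi.2.mono hwT⟩
  have hdfin := h.legal.finite_doneTasks ℓ T
  have hdfin' : (doneTasks A E S ℓ T \ doneTasks A E S ℓ w).Finite := hdfin.subset Set.sdiff_subset
  rw [← Set.ncard_sdiff_add_ncard_of_subset hsub hdfin, add_comm]
  refine Nat.add_le_add_right ?_ _
  let K : Finset (Σ _ : Fin P.m, Σ _ : ℝ, ℝ) := Finset.univ.sigma fun p =>
    (restarts E p T).sigma fun r => (hfin p r).toFinset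
  have hK : K.card = ∑ p, ∑ r ∈ restarts E p T, (cycles A S p r (phaseEnd E p r T) w ℓ).ncard := by
    simp only [K, Finset.card_sigma, Set.ncard_eq_toFinset_card _ (hfin _ _)]
  have hmem : ∀ x ∈ K, E.AliveSince x.1 x.2.1 x.2.2 ∧ w < x.2.2 ∧ x.2.2 + ℓ ≤ T ∧
      (∀ c ∈ E.crash x.1, x.2.2 < c → x.2.2 + ℓ ≤ c) ∧
      ∃ i, S x.1 x.2.2 = some i ∧ A.size i = ℓ := by
    rintro ⟨p, r, s⟩ hx
    simp only [K, Finset.mem_sigma, Finset.mem_univ, true_and, mem_restarts,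
      Set.Finite.mem_toFinset] at hx
    obtain ⟨⟨hr, -⟩, hs⟩ := hx
    obtain ⟨i, hi, hsz⟩ := exists_of_dur_pos (A := A) (hs.2.2.2 ▸ hℓ)
    exact ⟨aliveSince_of_lt_phaseEnd hr hs.1 (cycles_subset_starts hℓ hs).2.1, hs.2.1,
      hs.2.2.1.trans phaseEnd_le,
      fun c hc hsc => hs.2.2.1.trans (phaseEnd_le_crash hc (hs.1.trans_lt hsc)), i, hi,
      hsz.trans hs.2.2.2⟩
  rw [← hK, Set.ncard_eq_toFinset_card _ hdfin']
  refine Finset.card_le_card_of_injOn (fun x => (S x.1 x.2.2).getD 0) ?_ ?_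
  · intro x hx
    obtain ⟨-, hws, hsT, hc, i, hi, hsz⟩ := hmem x hx
    simp only [Set.Finite.coe_toFinset, hi, Option.getD_some]
    refine ⟨⟨hsz, x.1, x.2.2, hi, by rwa [hsz], by rwa [hsz]⟩, fun hd => ?_⟩
    exact (h.legal _ _ _ hi).2.2.2.2 (hd.2.mono hws.le)
  · intro x hx y hy hxy
    obtain ⟨ax, hwx, hxT, hcx, i, hi, hsz⟩ := hmem x hx
    obtain ⟨ay, hwy, hyT, hcy, j, hj, -⟩ := hmem y hy
    simp only [hi, hj, Option.getD_some] at hxy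
    subst hxy
    have := h.legal.eq_of_atOwnPosition hi hj (by rwa [hsz]) (by rwa [hsz])
      (h.atOwnPosition hi (hq _ hwx (by linarith))) (h.atOwnPosition hj (hq _ hwy (by linarith)))
    obtain ⟨p, r, s⟩ := x
    obtain ⟨p', r', s'⟩ := y
    obtain ⟨rfl, rfl⟩ := this
    obtain rfl : r = r' := aliveSince_unique ax ay
    rfl

/-! ### The last short queue, and phases that straddle it -/

/-- Let `w` be the last time by `T` when the queue `L_ℓ` was short: at this time, few tasks of size
`ℓ` have been completed by another algorithm but not by this one. -/
theorem exists_window (hS : Legal A E S) (hY : Legal A E Y) {ℓ : ℝ} (hℓ : 0 < ℓ) {K : ℕ}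
    (hK : 0 < K) (T : ℝ) : ∃ w ≤ T, (∀ v, w < v → v ≤ T → K ≤ (queue A E S ℓ v).ncard) ∧
      (doneTasks A E Y ℓ w).ncard ≤ (doneTasks A E S ℓ w).ncard + K + P.m := by
  set B := {u | u ≤ T ∧ (queue A E S ℓ u).ncard < K} with hB
  have hbdd : BddAbove B := ⟨T, fun u hu => hu.1⟩
  have hne : B.Nonempty := by
    -- Before time 0 nothing is pending; `T` itself may be negative.
    refine ⟨min T (-1), min_le_left _ _, ?_⟩
    have : queue A E S ℓ (min T (-1)) = ∅ := by
      rw [Set.eq_empty_iff_forall_notMem]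
      rintro i ⟨⟨h1, h2, -⟩, -⟩
      have := A.arr_nonneg i h1
      have := min_le_right T (-1)
      linarith
    rwa [this, Set.ncard_empty]
  refine ⟨sSup B, csSup_le hne fun u hu => hu.1, ?_, ?_⟩
  · intro v hv hvT
    by_contra hlt
    exact (le_csSup hbdd ⟨hvT, not_le.mp hlt⟩).not_gt hv
  -- The supremum need not be attained. A time `u` less than ℓ before it serves, at the price of the
  -- at most m tasks that Y completes in between.
  · obtain ⟨u, hu, hlt⟩ := exists_lt_of_lt_csSup hne (sub_lt_self (sSup B) hℓ)
    have huw : u ≤ sSup B := le_csSup hbdd hu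
    have h1 : (doneTasks A E Y ℓ (sSup B) \ doneTasks A E Y ℓ u).ncard ≤ 1 * P.m := by
      refine hY.ncard_le_of_completed_between (u := u) (v := sSup B) hℓ ?_ ?_
      · rw [Nat.cast_one, one_mul]
        linarith
      · rintro i ⟨hi, hi'⟩
        exact ⟨hi.1, fun hc => hi' ⟨hi.1, hc⟩, hi.2⟩
    have h2 : doneTasks A E Y ℓ u ⊆ doneTasks A E S ℓ u ∪ queue A E S ℓ u := by
      rintro i ⟨hsz, hc⟩
      obtain ⟨ht, ha⟩ := hY.mem_of_completed hc
      by_cases hcs : Completed A E S u i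
      · exact Or.inl ⟨hsz, hcs⟩
      · exact Or.inr ⟨⟨ht, ha, hcs⟩, hsz⟩
    have h3 := Set.ncard_le_ncard h2 ((hS.finite_doneTasks ℓ u).union (queue_finite ℓ u))
    have h4 := Set.ncard_union_le (doneTasks A E S ℓ u) (queue A E S ℓ u)
    have h5 := hS.ncard_doneTasks_mono (ℓ := ℓ) huw
    have h6 := Set.ncard_le_ncard_sdiff_add_ncard (doneTasks A E Y ℓ (sSup B))
      (doneTasks A E Y ℓ u) (hY.finite_doneTasks ℓ u)
    have h7 := hu.2
    omega

open Classical in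
-- Each machine has at most one phase running at time `w`, so an error made only in such phases is
-- paid once per machine.
theorem sum_aliveSince_le (E : ErrorPattern P) (w T : ℝ) {C : ℝ} (hC : 0 ≤ C) :
    ∑ p, ∑ r ∈ restarts E p T, (if E.AliveSince p r w then C else 0) ≤ P.m * C := by
  have h1 : ∀ p, ∑ r ∈ restarts E p T, (if E.AliveSince p r w then C else 0) ≤ C := by
    intro p
    rw [← Finset.sum_filter, Finset.sum_const, nsmul_eq_mul]
    have : ({r ∈ restarts E p T | E.AliveSince p r w}.card : ℝ) ≤ 1 := by
      exact_mod_cast Finset.card_le_one.mpr fun a ha b hb =>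
        aliveSince_unique (Finset.mem_filter.mp ha).2 (Finset.mem_filter.mp hb).2
    exact mul_le_of_le_one_left hC this
  refine (Finset.sum_le_sum fun p _ => h1 p).trans (le_of_eq ?_)
  simp

theorem cycles_eq_empty_of_not_aliveSince {p : Fin P.m} {r w T ℓ : ℝ} (hr : r ∈ E.restart p)
    (hrw : r ≤ w) (hal : ¬ E.AliveSince p r w) :
    cycles A Y p r (phaseEnd E p r T) (w - ℓ) ℓ = ∅ := by
  rw [Set.eq_empty_iff_forall_notMem]
  rintro s ⟨-, h2, h3, -⟩
  exact hal (aliveSince_of_lt_phaseEnd (T := T) hr hrw (by linarith))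

theorem le_phaseEnd_of_aliveSince {p : Fin P.m} {r w T : ℝ} (hwT : w ≤ T)
    (hal : E.AliveSince p r w) : w ≤ phaseEnd E p r T :=
  le_phaseEnd hwT fun c hc hrc => (hal.2.2 c hc hrc).le

/-! ### Comparison within one phase -/

/-- Put D = ℓmax + `rhoBar`·ℓmin. If L ≥ `rhoBar`·ℓmin, the load of the run is at least
`rhoBar`·ℓmin, which suffices for L ≤ D, and exceeds L - ℓmax, which suffices for L ≥ D. If L is
smaller, then y = 0 and x ≤ a. -/
theorem System.small_phase_bound (P : System) {L : ℝ} {x y a b : ℕ}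
    (hX : P.ℓmin * x + P.ℓmax * y ≤ L) (hA : L - P.ℓmax < P.ℓmin * a + P.ℓmax * b)
    (hpre : ∀ j ≤ P.rhoBar, j * P.ℓmin ≤ L → j ≤ a) :
    P.rhoBar * P.ℓmin * (P.ℓmin * x + P.ℓmax * y) ≤
      (P.ℓmax + P.rhoBar * P.ℓmin) * (P.ℓmin * a + P.ℓmax * b) := by
  have hp := P.ℓmin_pos
  have hM := P.ℓmax_pos
  have hk := P.rhoBar_mul_le
  set k : ℝ := (P.rhoBar : ℝ)
  have hk0 : 0 ≤ k := Nat.cast_nonneg _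
  have hkl : 0 ≤ k * P.ℓmin := by positivity
  have hb : 0 ≤ P.ℓmax * (b : ℝ) := by positivity
  rcases le_or_gt (k * P.ℓmin) L with hL | hL
  · have h1 : k ≤ a := Nat.cast_le.mpr (hpre P.rhoBar le_rfl hL)
    have h2 : k * P.ℓmin ≤ P.ℓmin * a := by nlinarith
    have h3 : k * P.ℓmin * (P.ℓmin * x + P.ℓmax * y) ≤ k * P.ℓmin * L := by gcongr
    rcases le_total L (P.ℓmax + k * P.ℓmin) with h4 | h4
    · calc _ ≤ k * P.ℓmin * L := h3
        _ ≤ k * P.ℓmin * (P.ℓmax + k * P.ℓmin) := by gcongr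
        _ = (P.ℓmax + k * P.ℓmin) * (k * P.ℓmin) := by ring
        _ ≤ _ := by gcongr; linarith
    · calc _ ≤ k * P.ℓmin * L := h3
        _ ≤ (P.ℓmax + k * P.ℓmin) * (L - P.ℓmax) := by nlinarith
        _ ≤ _ := by gcongr
  · have hx : 0 ≤ P.ℓmin * (x : ℝ) := by positivity
    have hy : y = 0 := by
      by_contra hne
      have : (1 : ℝ) ≤ y := by exact_mod_cast Nat.one_le_iff_ne_zero.mpr hne
      nlinarith
    subst hy
    simp only [Nat.cast_zero, mul_zero, add_zero] at hX ⊢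
    have h1 : (x : ℝ) < k := by nlinarith
    have h2 : x ≤ a := hpre x ((Nat.cast_le (α := ℝ)).mp h1.le) (by linarith)
    have h3 : (x : ℝ) ≤ a := by exact_mod_cast h2
    gcongr
    · linarith
    · have : P.ℓmin * (x : ℝ) ≤ P.ℓmin * a := by gcongr
      linarith

/-- Without preamble, rounding gives y ≤ b. With a preamble and y ≥ 1, the phase is long enough for
a = `rhoBar`; then y ≤ b + 1, and the small tasks pay for the one extra large task. -/
theorem System.large_phase_bound (P : System) {L : ℝ} {y a b : ℕ}
    (hX : P.ℓmax * y ≤ L) (hA : L - P.ℓmax < P.ℓmin * a + P.ℓmax * b) (ha : a ≤ P.rhoBar)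
    (hpre : a = 0 ∨ ∀ j ≤ P.rhoBar, j * P.ℓmin ≤ L → j ≤ a) :
    P.rhoBar * P.ℓmin * y ≤ (P.ℓmax + P.rhoBar * P.ℓmin) * b + P.ℓmin * a := by
  have hp := P.ℓmin_pos
  have hM := P.ℓmax_pos
  have hk := P.rhoBar_mul_le
  have hkl : 0 ≤ (P.rhoBar : ℝ) * P.ℓmin := by positivity
  have hb : 0 ≤ P.ℓmax * (b : ℝ) := by positivity
  have ha0 : 0 ≤ P.ℓmin * (a : ℝ) := by positivity
  rcases Nat.eq_zero_or_pos y with rfl | hy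
  · simp only [Nat.cast_zero, mul_zero]
    positivity
  rcases hpre with rfl | hpre
  · simp only [Nat.cast_zero, mul_zero, zero_add, add_zero] at hA ⊢
    have h1 : (y : ℝ) < b + 1 := by nlinarith
    have h2 : (y : ℝ) ≤ b := by exact_mod_cast Nat.lt_succ_iff.mp (by exact_mod_cast h1)
    gcongr
    linarith
  · have hy1 : (1 : ℝ) ≤ y := by exact_mod_cast hy
    have h1 : P.rhoBar ≤ a := hpre _ le_rfl (by nlinarith)
    obtain rfl : a = P.rhoBar := le_antisymm ha h1
    have h2 : (y : ℝ) < b + 2 := by nlinarith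
    have h3 : (y : ℝ) ≤ b + 1 := by
      exact_mod_cast Nat.lt_succ_iff.mp (show y < (b + 1) + 1 by exact_mod_cast h2)
    nlinarith

open Classical in
theorem IsRun.load_of_small_queue_long (h : IsRun A E S) (hY : Legal A E Y) {w T : ℝ} (hwT : w ≤ T)
    (hq : ∀ v, w < v → v ≤ T → P.rhoBar * P.m ^ 2 ≤ (queue A E S P.ℓmin v).ncard)
    {p : Fin P.m} {r : ℝ} (hr : r ∈ restarts E p T) :
    P.rhoBar * P.ℓmin *
        (P.ℓmin * (cycles A Y p r (phaseEnd E p r T) (w - P.ℓmin) P.ℓmin).ncard +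
          P.ℓmax * (cycles A Y p r (phaseEnd E p r T) (w - P.ℓmax) P.ℓmax).ncard) ≤
      (P.ℓmax + P.rhoBar * P.ℓmin) *
        (P.ℓmin * (cycles A S p r (phaseEnd E p r T) w P.ℓmin).ncard +
          P.ℓmax * (cycles A S p r (phaseEnd E p r T) w P.ℓmax).ncard) +
      if E.AliveSince p r w then (P.ℓmax + P.rhoBar * P.ℓmin) * (3 * P.ℓmax) else 0 := by
  obtain ⟨hr, hrT⟩ := mem_restarts.mp hr
  have hp := P.ℓmin_pos
  have hM := P.ℓmax_pos
  have hlt := P.ℓmin_lt_ℓmax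
  have hlong : LongQueue A E S w T := fun v hv hvT => by
    have h1 := hq v hv hvT
    have h2 : 1 * P.m ^ 2 ≤ P.rhoBar * P.m ^ 2 := Nat.mul_le_mul_right _ P.one_le_rhoBar
    omega
  have hre : r ≤ phaseEnd E p r T := le_phaseEnd hrT fun c _ hrc => hrc.le
  rcases lt_or_ge w r with hwr | hrw
  · rw [if_neg fun hal => hwr.not_ge hal.2.1, add_zero]
    exact P.small_phase_bound (hY.load_le hre (Or.inl le_rfl))
      (h.lt_load hlong hr le_rfl hwr (Or.inl rfl))
      fun j hj hje => h.le_ncard_of_enoughSmall hlong hr hwr (hq r hwr hrT) hj hje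
  · by_cases hal : E.AliveSince p r w
    · rw [if_pos hal]
      have hwe := le_phaseEnd_of_aliveSince hwT hal
      have h1 := hY.load_le (p := p) (r := r) (T := T) (w := w - P.ℓmin) (w' := w - P.ℓmax)
        (b := w - P.ℓmax) (by linarith) (Or.inr ⟨by linarith, le_rfl⟩)
      -- The competitor is counted from w - ℓmax, the run from w + ℓmax, and one more ℓmax is lost
      -- to an interrupted cycle: hence 3ℓmax.
      have h2 := h.lt_load hlong hr (b := w + P.ℓmax) (by linarith) (by linarith)
        (Or.inr le_rfl)
      have hkl : 0 ≤ (P.rhoBar : ℝ) * P.ℓmin := by positivity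
      rw [← mul_add]
      refine mul_le_mul (by linarith) (by linarith) (by positivity) (by linarith)
    · rw [if_neg hal, add_zero, cycles_eq_empty_of_not_aliveSince hr hrw hal,
        cycles_eq_empty_of_not_aliveSince hr hrw hal]
      simp only [Set.ncard_empty, Nat.cast_zero, mul_zero, add_zero]
      positivity

open Classical in
theorem IsRun.load_of_large_queue_long (h : IsRun A E S) (hY : Legal A E Y) {w T : ℝ} (hwT : w ≤ T)
    (hq : ∀ v, w < v → v ≤ T → P.m ^ 2 ≤ (queue A E S P.ℓmax v).ncard)
    {p : Fin P.m} {r : ℝ} (hr : r ∈ restarts E p T) :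
    P.rhoBar * P.ℓmin * (cycles A Y p r (phaseEnd E p r T) (w - P.ℓmax) P.ℓmax).ncard ≤
      (P.ℓmax + P.rhoBar * P.ℓmin) * (cycles A S p r (phaseEnd E p r T) w P.ℓmax).ncard +
        P.ℓmin * (cycles A S p r (phaseEnd E p r T) w P.ℓmin).ncard +
      if E.AliveSince p r w then (P.ℓmax + P.rhoBar * P.ℓmin) * 4 else 0 := by
  obtain ⟨hr, hrT⟩ := mem_restarts.mp hr
  have hp := P.ℓmin_pos
  have hM := P.ℓmax_pos
  have hlt := P.ℓmin_lt_ℓmax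
  have hk := P.rhoBar_mul_le
  have hlong : LongQueue A E S w T := fun v hv hvT => Or.inr (hq v hv hvT)
  have hre : r ≤ phaseEnd E p r T := le_phaseEnd hrT fun c _ hrc => hrc.le
  have hsmall := h.ncard_small_le hr hq
  rcases lt_or_ge w r with hwr | hrw
  · rw [if_neg fun hal => hwr.not_ge hal.2.1, add_zero]
    refine P.large_phase_bound ?_ (h.lt_load hlong hr le_rfl hwr (Or.inl rfl)) hsmall ?_
    · refine le_trans ?_ (hY.load_le (w := w) (w' := w - P.ℓmax) hre (Or.inl le_rfl))
      exact le_add_of_nonneg_left (by positivity)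
    · by_cases hE : EnoughSmall A E S r
      · exact Or.inr fun j hj hje => h.le_ncard_of_enoughSmall hlong hr hwr hE hj hje
      · left
        rw [h.cycles_small_eq_empty hr hwr hq hE, Set.ncard_empty]
  · by_cases hal : E.AliveSince p r w
    · rw [if_pos hal]
      have hwe := le_phaseEnd_of_aliveSince hwT hal
      have h1 := hY.load_le (p := p) (r := r) (T := T) (w := w) (w' := w - P.ℓmax)
        (b := w - P.ℓmax) (by linarith) (Or.inr ⟨by linarith, le_rfl⟩)
      have h2 := h.lt_load hlong hr (b := w + P.ℓmax) (by linarith) (by linarith)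
        (Or.inr le_rfl)
      generalize (cycles A Y p r (phaseEnd E p r T) (w - P.ℓmax) P.ℓmax).ncard = y at *
      generalize (cycles A Y p r (phaseEnd E p r T) w P.ℓmin).ncard = x at *
      generalize (cycles A S p r (phaseEnd E p r T) w P.ℓmin).ncard = a at *
      generalize (cycles A S p r (phaseEnd E p r T) w P.ℓmax).ncard = b at *
      have ha : P.ℓmin * (a : ℝ) ≤ P.rhoBar * P.ℓmin := by
        rw [mul_comm]
        gcongr
      have hx : 0 ≤ P.ℓmin * (x : ℝ) := by positivity
      have ha0 : 0 ≤ P.ℓmin * (a : ℝ) := by positivity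
      have hkl : 0 ≤ (P.rhoBar : ℝ) * P.ℓmin := by positivity
      -- Three large tasks come from the shifted windows and the interrupted cycle; the fourth
      -- covers the small tasks of the run, whose load is at most `rhoBar`·ℓmin ≤ ℓmax.
      have hy : (y : ℝ) ≤ b + 4 := by
        have : P.ℓmax * (y : ℝ) ≤ P.ℓmax * (b + 4) := by linarith
        exact le_of_mul_le_mul_left this hM
      have h3 : P.rhoBar * P.ℓmin * (y : ℝ) ≤ (P.ℓmax + P.rhoBar * P.ℓmin) * (b + 4) :=
        mul_le_mul (by linarith) hy (by positivity) (by linarith)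
      linarith
    · rw [if_neg hal, add_zero, cycles_eq_empty_of_not_aliveSince hr hrw hal]
      simp only [Set.ncard_empty, Nat.cast_zero, mul_zero]
      positivity

/-! ### Summation over phases and conclusion -/

theorem IsRun.completed_of_small_queue_long (h : IsRun A E S) (hY : Legal A E Y) {w T : ℝ}
    (hwT : w ≤ T)
    (hq : ∀ v, w < v → v ≤ T → P.rhoBar * P.m ^ 2 ≤ (queue A E S P.ℓmin v).ncard) :
    P.rhoBar * P.ℓmin * (completedLoad A E Y T - completedLoad A E Y w) ≤
      (P.ℓmax + P.rhoBar * P.ℓmin) * (completedLoad A E S T - completedLoad A E S w) +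
        P.m * ((P.ℓmax + P.rhoBar * P.ℓmin) * (3 * P.ℓmax)) := by
  classical
  have hp := P.ℓmin_pos
  have hM := P.ℓmax_pos
  have hlong : LongQueue A E S w T := fun v hv hvT => by
    have h1 := hq v hv hvT
    have h2 : 1 * P.m ^ 2 ≤ P.rhoBar * P.m ^ 2 := Nat.mul_le_mul_right _ P.one_le_rhoBar
    omega
  have hsum := Finset.sum_le_sum fun p (_ : p ∈ Finset.univ) => Finset.sum_le_sum
    fun r (hr : r ∈ restarts E p T) => h.load_of_small_queue_long hY hwT hq hr
  simp only [Finset.sum_add_distrib, ← Finset.mul_sum] at hsum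
  have herr := sum_aliveSince_le E w T
    (C := (P.ℓmax + P.rhoBar * P.ℓmin) * (3 * P.ℓmax)) (by positivity)
  have y1 : (_ : ℝ) ≤ _ := Nat.cast_le.mpr (hY.ncard_doneTasks_le hp w T)
  have y2 : (_ : ℝ) ≤ _ := Nat.cast_le.mpr (hY.ncard_doneTasks_le hM w T)
  have s1 : (_ : ℝ) ≤ _ := Nat.cast_le.mpr (h.le_ncard_doneTasks hp hwT hlong)
  have s2 : (_ : ℝ) ≤ _ := Nat.cast_le.mpr (h.le_ncard_doneTasks hM hwT hlong)
  push_cast at y1 y2 s1 s2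
  rw [hY.completedLoad_eq, hY.completedLoad_eq, h.legal.completedLoad_eq, h.legal.completedLoad_eq]
  refine le_trans (mul_le_mul_of_nonneg_left ?_ (by positivity))
    (hsum.trans (add_le_add (mul_le_mul_of_nonneg_left ?_ (by positivity)) herr))
  · have := mul_le_mul_of_nonneg_left y1 hp.le
    have := mul_le_mul_of_nonneg_left y2 hM.le
    linarith
  · have := mul_le_mul_of_nonneg_left s1 hp.le
    have := mul_le_mul_of_nonneg_left s2 hM.le
    linarith

theorem IsRun.completed_of_large_queue_long (h : IsRun A E S) (hY : Legal A E Y) {w T : ℝ}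
    (hwT : w ≤ T) (hq : ∀ v, w < v → v ≤ T → P.m ^ 2 ≤ (queue A E S P.ℓmax v).ncard) :
    P.rhoBar * P.ℓmin * ((doneTasks A E Y P.ℓmax T).ncard - (doneTasks A E Y P.ℓmax w).ncard : ℝ) ≤
      (P.ℓmax + P.rhoBar * P.ℓmin) *
          ((doneTasks A E S P.ℓmax T).ncard - (doneTasks A E S P.ℓmax w).ncard : ℝ) +
        P.ℓmin * ((doneTasks A E S P.ℓmin T).ncard - (doneTasks A E S P.ℓmin w).ncard : ℝ) +
        P.m * ((P.ℓmax + P.rhoBar * P.ℓmin) * 4) := by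
  classical
  have hp := P.ℓmin_pos
  have hM := P.ℓmax_pos
  have hlong : LongQueue A E S w T := fun v hv hvT => Or.inr (hq v hv hvT)
  have hsum := Finset.sum_le_sum fun p (_ : p ∈ Finset.univ) => Finset.sum_le_sum
    fun r (hr : r ∈ restarts E p T) => h.load_of_large_queue_long hY hwT hq hr
  simp only [Finset.sum_add_distrib, ← Finset.mul_sum] at hsum
  have herr := sum_aliveSince_le E w T
    (C := (P.ℓmax + P.rhoBar * P.ℓmin) * 4) (by positivity)
  have y2 : (_ : ℝ) ≤ _ := Nat.cast_le.mpr (hY.ncard_doneTasks_le hM w T)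
  have s1 : (_ : ℝ) ≤ _ := Nat.cast_le.mpr (h.le_ncard_doneTasks hp hwT hlong)
  have s2 : (_ : ℝ) ≤ _ := Nat.cast_le.mpr (h.le_ncard_doneTasks hM hwT hlong)
  push_cast at y2 s1 s2
  refine le_trans (mul_le_mul_of_nonneg_left ?_ (by positivity))
    (hsum.trans (add_le_add (add_le_add (mul_le_mul_of_nonneg_left ?_ (by positivity))
      (mul_le_mul_of_nonneg_left ?_ hp.le)) herr)) <;> linarith

theorem IsRun.competitive (h : IsRun A E S) (hY : Legal A E Y) (t : ℝ) :
    P.rhoBar * P.ℓmin * completedLoad A E Y t ≤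
      (P.ℓmax + P.rhoBar * P.ℓmin) * completedLoad A E S t +
      (P.rhoBar * P.ℓmin * (P.ℓmin * (P.rhoBar * P.m ^ 2 + P.m) + P.ℓmax * (P.m ^ 2 + P.m)) +
        P.m * ((P.ℓmax + P.rhoBar * P.ℓmin) * (7 * P.ℓmax))) := by
  have hp := P.ℓmin_pos
  have hM := P.ℓmax_pos
  have hm := P.m_pos
  have hkpos := P.one_le_rhoBar
  obtain ⟨u, hut, hu, hu'⟩ := exists_window h.legal hY hp (K := P.rhoBar * P.m ^ 2)
    (by positivity) t
  obtain ⟨w, hwu, hw, hw'⟩ := exists_window h.legal hY hM (K := P.m ^ 2) (by positivity) u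
  have hA := h.completed_of_small_queue_long hY hut hu
  have hB := h.completed_of_large_queue_long hY hwu hw
  rw [hY.completedLoad_eq u, h.legal.completedLoad_eq u] at hA
  have hu'' : (_ : ℝ) ≤ _ := Nat.cast_le.mpr hu'
  have hw'' : (_ : ℝ) ≤ _ := Nat.cast_le.mpr hw'
  push_cast at hu'' hw''
  set k : ℝ := (P.rhoBar : ℝ)
  have hkl : 0 ≤ k * P.ℓmin := by positivity
  have e1 := mul_le_mul_of_nonneg_left hw'' hkl
  have e2 := mul_le_mul_of_nonneg_left hu'' (mul_nonneg hkl hp.le)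
  have e3 : 0 ≤ P.ℓmin * ((doneTasks A E S P.ℓmin w).ncard : ℝ) := by positivity
  have e4 : 0 ≤ P.ℓmax * ((doneTasks A E S P.ℓmax w).ncard : ℝ) := by positivity
  have e5 : k * P.ℓmin * ((doneTasks A E Y P.ℓmax u).ncard : ℝ) ≤
      (P.ℓmax + k * P.ℓmin) * (doneTasks A E S P.ℓmax u).ncard +
        P.ℓmin * (doneTasks A E S P.ℓmin u).ncard + k * P.ℓmin * (P.m ^ 2 + P.m) +
        P.m * ((P.ℓmax + k * P.ℓmin) * 4) := by
    linarith
  -- The factor ℓmax turns the count of large tasks into load. It also turns the error 4 into 4ℓmax,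
  -- which with the 3ℓmax from after `u` gives the 7ℓmax of the statement.
  have e6 := mul_le_mul_of_nonneg_left e5 hM.le
  linarith

end CrashScheduling

end

theorem theoremt (P : CrashScheduling.System) :
    CrashScheduling.CompletedLoadCompetitive (CrashScheduling.rhoMPreamble P)
      ((P.rhoBar : ℝ) / (P.rho + (P.rhoBar : ℝ))) := by
  have hp := P.ℓmin_pos
  have hM := P.ℓmax_pos
  have hD : 0 < P.ℓmax + P.rhoBar * P.ℓmin := by positivity
  -- This is the additive error of `IsRun.competitive`, divided by the coefficient of the load of
  -- the run.
  refine ⟨-((P.rhoBar * P.ℓmin * (P.ℓmin * (P.rhoBar * P.m ^ 2 + P.m) + P.ℓmax * (P.m ^ 2 + P.m)) +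
    P.m * ((P.ℓmax + P.rhoBar * P.ℓmin) * (7 * P.ℓmax))) / (P.ℓmax + P.rhoBar * P.ℓmin)), ?_⟩
  intro t X A E _
  have hα : (P.rhoBar : ℝ) / (P.rho + P.rhoBar) =
      P.rhoBar * P.ℓmin / (P.ℓmax + P.rhoBar * P.ℓmin) := by
    rw [CrashScheduling.System.rho]
    field_simp
  have h := CrashScheduling.IsRun.competitive
    (CrashScheduling.exists_isRun A E).choose_spec (X.legal A E) t
  rw [hα, ge_iff_le, ← sub_eq_add_neg, div_mul_eq_mul_div, ← sub_div, div_le_iff₀ hD]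
  change _ ≤ CrashScheduling.completedLoad A E (CrashScheduling.exists_isRun A E).choose t * _
  linarith
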